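/- **Setting.** Let $\mathcal H=\ell^2(\mathbb Z)$ with canonical basis $(e_i)_{i\in\mathbb Z}$ and shift $Ue_i=e_{i+1}$. A *selfadjoint Yang–Baxter–Hecke operator* is a bounded selfadjoint operator $T$ on $\mathcal H\otimes\mathcal H$ with $T\ge -I$, with $T_1T_2T_1=T_2T_1T_2$ on $\mathcal H^{\otimes 3}$ (where $T_1=T\otimes I$, $T_2=I\otimes T$), and with $T^2=(q-1)T+qI$ for some real $q\ge -1$. On $\mathcal H^{\otimes n}$ let $T_k=I^{\otimes(k-1)}\otimes T\otimes I^{\otimes(n-k-1)}$, $$R^{(n)}=I+T_1+T_1T_2+\dots+T_1T_2\cdots T_{n-1},\qquad P^{(0)}=I,\qquad P^{(n+1)}=(I\otimes P^{(n)})R^{(n+1)} .$$ Then $P^{(n)}\ge 0$. Let $\mathcal H_T^n$ be the Hilbert space obtained from $\mathcal H^{\otimes n}$ with the form $\langle\xi,\eta\rangle_T=\langle\xi,P^{(n)}\eta\rangle$ by dividing out the null vectors and completing, let $\mathcal F_T=\bigoplus_{n\ge0}\mathcal H_T^n$ (Hilbert space direct sum), and let $E^n$ be the orthogonal projection of $\mathcal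 F_T$ onto $\mathcal H_T^n$. The creation operator $a^\dagger(f):\mathcal H_T^n\to\mathcal H_T^{n+1}$ is the bounded operator induced by $\xi\mapsto f\otimes\xi$; the annihilation operator $a(f):\mathcal H_T^{n+1}\to\mathcal H_T^n$ is its adjoint, and $a(f)=0$ on $\mathcal H_T^0$. Let $\mathfrak E_T\subseteq\mathcal B(\mathcal F_T)$ be the $C^*$-algebra generated by $I$ and all the operators $$E^m a^\sharp(e_{i_1})\cdots a^\sharp(e_{i_r})E^n,\qquad m,n,r\ge 0,\ i_1,\dots,i_r\in\mathbb Z,\ a^\sharp\in\{a,a^\dagger\}.$$ If $T$ commutes with $U\otimes U$, the operators $U^{\otimes n}$ induce a unitary $\mathcal F_T(U)$ of $\mathcal F_T$. **Proposition.** Let $T$ be a selfadjoint Yang–Baxter–Hecke operator on $\mathcal H\otimes\mathcal H$ that commutes with $U\otimes U$. Define $t_{ij}^{kl}$ by $T(e_i\otimes e_j)=\sum_{k,l}t_{ij}^{kl}\,e_k\otimes e_l$, and suppose that for all $i,j\in\mathbb Z$ only finitely many pairs $(k,l)$ have $t_{jl}^{ik}\neq0$, that is, that the sum in each commutation rule $a_ia_j^\dagger-\sum_{k,l}t_{jl}^{ik}a_k^\dagger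 a_l=\delta_{ij}I$ is finite. Then $A\mapsto\mathcal F_T(U)A\,\mathcal F_T(U)^*$ restricts to an automorphism $\alpha$ of $\mathfrak E_T$, and $(\mathfrak E_T,\alpha)$ is uniquely mixing with respect to the fixed-point subalgebra $\mathfrak E_T^{\mathbb Z}=\{A\in\mathfrak E_T:\alpha(A)=A\}$: there is exactly one $\alpha$-invariant conditional expectation $E$ of $\mathfrak E_T$ onto $\mathfrak E_T^{\mathbb Z}$, and $$\lim_{n\to+\infty}f(\alpha^n(A))=f(E(A))\qquad\text{for all }A\in\mathfrak E_T,\ f\in\mathfrak E_T^*.$$ This covers the Bose case: the flip $T(x\otimes y)=y\otimes x$ satisfies all the hypotheses, while $\sup_n\|R^{(n)}\|=\infty$. -/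

import Mathlib

namespace TFock

/-- The Hilbert space `ℓ²(α)`. -/
abbrev Ell2 (α : Type) : Type := lp (fun _ : α => ℂ) 2

theorem memlp_two_iff {ι : Type} {G : ι → Type} [∀ i, NormedAddCommGroup (G i)] (f : ∀ i, G i) :
    Memℓp f 2 ↔ Summable fun i => ‖f i‖ ^ 2 := by
  rw [memℓp_gen_iff (by norm_num)]
  norm_num

theorem hasSum_norm_sq {ι : Type} {G : ι → Type} [∀ i, NormedAddCommGroup (G i)]
    (ξ : lp G 2) : HasSum (fun i => ‖ξ i‖ ^ 2) (‖ξ‖ ^ 2) := by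
  have h := lp.hasSum_norm (p := 2) (by norm_num) ξ
  norm_num at h
  exact h

section Amplification

variable {α β γ : Type}

/-- The slice `a ↦ ξ (e (b, a))` of a vector of `ℓ²(γ)`, where `e : β × α ≃ γ`. -/
noncomputable def slice (e : β × α ≃ γ) (b : β) : Ell2 γ →ₗ[ℂ] Ell2 α where
  toFun ξ := ⟨fun a => ξ (e (b, a)), (memlp_two_iff _).2 <|
    ((hasSum_norm_sq ξ).summable.comp_injective e.injective).comp_injective
      (i := fun a : α => (b, a)) (fun _ _ h => (Prod.mk.inj h).2)⟩
  map_add' _ _ := rfl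
  map_smul' _ _ := rfl

theorem hasSum_slice (e : β × α ≃ γ) (ξ : Ell2 γ) :
    HasSum (fun b => ‖slice e b ξ‖ ^ 2) (‖ξ‖ ^ 2) :=
  (e.hasSum_iff.2 (hasSum_norm_sq ξ)).prod_fiberwise fun b => hasSum_norm_sq (slice e b ξ)

theorem amp_summable (e : β × α ≃ γ) (A : Ell2 α →L[ℂ] Ell2 α) (ξ : Ell2 γ) :
    Summable fun p : β × α => ‖A (slice e p.1 ξ) p.2‖ ^ 2 := by
  refine (summable_prod_of_nonneg fun _ => by positivity).2
    ⟨fun b => (hasSum_norm_sq (A (slice e b ξ))).summable, ?_⟩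
  refine Summable.of_nonneg_of_le (fun b => tsum_nonneg fun _ => by positivity) (fun b => ?_)
    ((hasSum_slice e ξ).summable.mul_left (‖A‖ ^ 2))
  rw [(hasSum_norm_sq (A (slice e b ξ))).tsum_eq, ← mul_pow]
  gcongr
  exact A.le_opNorm _

/-- Let `e : β × α ≃ γ`, which identifies `ℓ²(γ)` with `ℓ²(β) ⊗ ℓ²(α)`. For a bounded operator `A`
on `ℓ²(α)` this is the operator `I ⊗ A` on `ℓ²(γ)`: it applies `A` to every slice. -/
noncomputable def amp (e : β × α ≃ γ) (A : Ell2 α →L[ℂ] Ell2 α) : Ell2 γ →L[ℂ] Ell2 γ :=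
  LinearMap.mkContinuous
    { toFun := fun ξ => ⟨fun c => A (slice e (e.symm c).1 ξ) (e.symm c).2,
        (memlp_two_iff _).2 ((e.symm.summable_iff).2 (amp_summable e A ξ))⟩
      map_add' := fun ξ η => by
        ext c
        change A (slice e (e.symm c).1 (ξ + η)) (e.symm c).2 = _
        rw [map_add, map_add]; rfl
      map_smul' := fun r ξ => by
        ext c
        change A (slice e (e.symm c).1 (r • ξ)) (e.symm c).2 = _
        rw [map_smul, map_smul]; rfl } ‖A‖ (fun ξ => by
      refine (sq_le_sq₀ (norm_nonneg _) (mul_nonneg (norm_nonneg _) (norm_nonneg _))).1 ?_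
      refine hasSum_le_of_sum_le (hasSum_norm_sq _) ?_
      intro s
      refine ((e.symm.summable_iff).2 (amp_summable e A ξ)).sum_le_tsum s
        (fun _ _ => sq_nonneg _) |>.trans ?_
      change ∑' c, (fun p : β × α => ‖A (slice e p.1 ξ) p.2‖ ^ 2) (e.symm c) ≤ _
      rw [e.symm.tsum_eq (fun p : β × α => ‖A (slice e p.1 ξ) p.2‖ ^ 2),
        (amp_summable e A ξ).tsum_prod]
      simp_rw [fun b => (hasSum_norm_sq (A (slice e b ξ))).tsum_eq]
      rw [mul_pow, ← (hasSum_slice e ξ).tsum_eq, ← tsum_mul_left]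
      have hb : ∀ b, ‖A (slice e b ξ)‖ ^ 2 ≤ ‖A‖ ^ 2 * ‖slice e b ξ‖ ^ 2 := fun b => by
        rw [← mul_pow]; gcongr; exact A.le_opNorm _
      have hs := (hasSum_slice e ξ).summable.mul_left (‖A‖ ^ 2)
      exact (Summable.of_nonneg_of_le (fun _ => by positivity) hb hs).tsum_le_tsum hb hs)

theorem slice_amp (e : β × α ≃ γ) (A : Ell2 α →L[ℂ] Ell2 α) (b : β) (ξ : Ell2 γ) :
    slice e b (amp e A ξ) = A (slice e b ξ) := by
  ext a
  change A (slice e (e.symm (e (b, a))).1 ξ) (e.symm (e (b, a))).2 = _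
  rw [e.symm_apply_apply]

theorem ext_slice (e : β × α ≃ γ) {ξ η : Ell2 γ} (h : ∀ b, slice e b ξ = slice e b η) : ξ = η := by
  ext c
  obtain ⟨⟨b, a⟩, rfl⟩ := e.surjective c
  exact congrFun (congrArg (fun v : Ell2 α => (v : α → ℂ)) (h b)) a

theorem amp_one (e : β × α ≃ γ) : amp e 1 = 1 := by
  ext1 ξ
  exact ext_slice e fun b => by rw [slice_amp]; rfl

theorem amp_mul (e : β × α ≃ γ) (A B : Ell2 α →L[ℂ] Ell2 α) :
    amp e (A * B) = amp e A * amp e B := by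
  ext1 ξ
  refine ext_slice e fun b => ?_
  change _ = slice e b (amp e A (amp e B ξ))
  rw [slice_amp, slice_amp, slice_amp]; rfl

theorem amp_add (e : β × α ≃ γ) (A B : Ell2 α →L[ℂ] Ell2 α) :
    amp e (A + B) = amp e A + amp e B := by
  ext1 ξ
  refine ext_slice e fun b => ?_
  rw [add_apply, map_add, slice_amp, slice_amp, slice_amp]; rfl

theorem amp_smul (e : β × α ≃ γ) (r : ℂ) (A : Ell2 α →L[ℂ] Ell2 α) :
    amp e (r • A) = r • amp e A := by
  ext1 ξ
  refine ext_slice e fun b => ?_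
  rw [smul_apply, map_smul, slice_amp, slice_amp]; rfl

theorem hasSum_inner_slice (e : β × α ≃ γ) (ξ η : Ell2 γ) :
    HasSum (fun b => inner ℂ (slice e b ξ) (slice e b η)) (inner ℂ ξ η) :=
  (e.hasSum_iff.2 (lp.hasSum_inner ξ η)).prod_fiberwise
    fun b => lp.hasSum_inner (slice e b ξ) (slice e b η)

theorem amp_star (e : β × α ≃ γ) (A : Ell2 α →L[ℂ] Ell2 α) : amp e (star A) = star (amp e A) := by
  rw [ContinuousLinearMap.star_eq_adjoint, ContinuousLinearMap.star_eq_adjoint]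
  refine (ContinuousLinearMap.eq_adjoint_iff _ _).2 fun ξ η => ?_
  refine (hasSum_inner_slice e _ _).unique ?_
  convert hasSum_inner_slice e ξ (amp e A η) using 2 with b
  rw [slice_amp, slice_amp, ContinuousLinearMap.adjoint_inner_left]

/-- `A ↦ I ⊗ A` as a homomorphism of algebras with involution. -/
noncomputable def ampHom (e : β × α ≃ γ) :
    (Ell2 α →L[ℂ] Ell2 α) →⋆ₐ[ℂ] (Ell2 γ →L[ℂ] Ell2 γ) where
  toFun := amp e
  map_one' := amp_one e
  map_mul' := amp_mul e
  map_zero' := by simpa using amp_smul e 0 (0 : Ell2 α →L[ℂ] Ell2 α)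
  map_add' := amp_add e
  commutes' r := by
    rw [Algebra.algebraMap_eq_smul_one, amp_smul, amp_one, Algebra.algebraMap_eq_smul_one]
  map_star' := amp_star e

/-- The product vector `u ⊗ v` of `ℓ²(γ) = ℓ²(β) ⊗ ℓ²(α)`, with coordinates
`(u ⊗ v) (e (b, a)) = u b * v a`. -/
noncomputable def tens (e : β × α ≃ γ) (u : Ell2 β) : Ell2 α →ₗ[ℂ] Ell2 γ where
  toFun v := ⟨fun c => u (e.symm c).1 * v (e.symm c).2, (memlp_two_iff _).2 <| by
    have h := (hasSum_norm_sq u).summable.mul_of_nonneg (hasSum_norm_sq v).summable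
      (fun _ => by positivity) (fun _ => by positivity)
    simp only [norm_mul, mul_pow]
    exact (e.symm.summable_iff).2 h⟩
  map_add' v w := by ext c; exact mul_add _ _ _
  map_smul' r v := by ext c; exact mul_left_comm _ _ _

theorem slice_tens (e : β × α ≃ γ) (u : Ell2 β) (v : Ell2 α) (b : β) :
    slice e b (tens e u v) = u b • v := by
  ext a
  change u (e.symm (e (b, a))).1 * v (e.symm (e (b, a))).2 = _
  rw [e.symm_apply_apply]; rfl

theorem amp_tens (e : β × α ≃ γ) (A : Ell2 α →L[ℂ] Ell2 α) (u : Ell2 β) (v : Ell2 α) :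
    amp e A (tens e u v) = tens e u (A v) :=
  ext_slice e fun b => by rw [slice_amp, slice_tens, slice_tens, map_smul]

theorem inner_tens (e : β × α ≃ γ) (u u' : Ell2 β) (v v' : Ell2 α) :
    inner ℂ (tens e u v) (tens e u' v') = inner ℂ u u' * inner ℂ v v' := by
  refine (hasSum_inner_slice e _ _).unique ?_
  have h := (lp.hasSum_inner u u').mul_right (inner ℂ v v')
  have hb : (fun b => inner ℂ (slice e b (tens e u v)) (slice e b (tens e u' v'))) =
      fun b => inner ℂ (u b) (u' b) * inner ℂ v v' := funext fun b => by
    rw [slice_tens, slice_tens, inner_smul_left, inner_smul_right, RCLike.inner_apply]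
    ring
  rw [hb]
  exact h

theorem tens_swap (e : β × α ≃ γ) (u : Ell2 β) (v : Ell2 α) :
    tens e u v = tens ((Equiv.prodComm α β).trans e) v u := by
  ext c
  exact mul_comm _ _

/-- `I ⊗ A` and `B ⊗ I` commute. -/
theorem amp_comm (e : β × α ≃ γ) (A : Ell2 α →L[ℂ] Ell2 α) (B : Ell2 β →L[ℂ] Ell2 β) :
    Commute (amp e A) (amp ((Equiv.prodComm α β).trans e) B) := by
  classical
  refine lp.ext_continuousLinearMap (𝕜 := ℂ) (by norm_num) fun c => ?_
  ext1
  obtain ⟨⟨b, a⟩, rfl⟩ := e.surjective c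
  have h : (lp.single 2 (e (b, a)) (1 : ℂ) : Ell2 γ) =
      tens e (lp.single 2 b (1 : ℂ)) (lp.single 2 a (1 : ℂ)) := by
    ext c
    obtain ⟨⟨b', a'⟩, rfl⟩ := e.surjective c
    change _ = (lp.single 2 b (1 : ℂ) : Ell2 β) (e.symm (e (b', a'))).1 *
      (lp.single 2 a (1 : ℂ) : Ell2 α) (e.symm (e (b', a'))).2
    rw [e.symm_apply_apply]
    simp only [lp.coeFn_single, Pi.single_apply, e.injective.eq_iff, Prod.mk.injEq]
    split_ifs <;> simp_all
  change amp e A (amp _ B (lp.single 2 (e (b, a)) (1 : ℂ))) =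
    amp _ B (amp e A (lp.single 2 (e (b, a)) (1 : ℂ)))
  rw [h, amp_tens, tens_swap e _ (A _), amp_tens, tens_swap, amp_tens, ← tens_swap, amp_tens,
    ← tens_swap]

/-- The unitary `ℓ²(α) ≃ ℓ²(β)` induced by a bijection; it sends `δ_a` to `δ_(e a)`. -/
noncomputable def reindex (e : α ≃ β) : Ell2 α ≃ₗᵢ[ℂ] Ell2 β where
  toFun ξ := ⟨fun b => ξ (e.symm b), (memlp_two_iff _).2
    ((hasSum_norm_sq ξ).summable.comp_injective e.symm.injective)⟩
  invFun ξ := ⟨fun a => ξ (e a), (memlp_two_iff _).2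
    ((hasSum_norm_sq ξ).summable.comp_injective e.injective)⟩
  map_add' _ _ := rfl
  map_smul' _ _ := rfl
  left_inv ξ := by ext a; exact congrArg ξ (e.symm_apply_apply a)
  right_inv ξ := by ext a; exact congrArg ξ (e.apply_symm_apply a)
  norm_map' ξ := by
    refine (sq_eq_sq₀ (norm_nonneg _) (norm_nonneg _)).1 ?_
    exact (hasSum_norm_sq _).unique (e.symm.hasSum_iff.2 (hasSum_norm_sq ξ))

end Amplification

section Braiding

/-- The Hilbert space tensor power `ℓ²(ℤ)^{⊗ n} = ℓ²(ℤⁿ)`; the vector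
`e_{i₁} ⊗ ⋯ ⊗ e_{iₙ}` is the unit mass at `(i₁, …, iₙ)`. -/
abbrev HPow (n : ℕ) : Type := Ell2 (Fin n → ℤ)

/-- `(i, (i₁, …, iₙ)) ↦ (i, i₁, …, iₙ)`, giving `H^{⊗ (n+1)} = H ⊗ H^{⊗ n}`. -/
def consE (n : ℕ) : ℤ × (Fin n → ℤ) ≃ (Fin (n + 1) → ℤ) := Fin.consEquiv fun _ => ℤ

/-- `((i₁, …, iₙ), (i, j)) ↦ (i, j, i₁, …, iₙ)`, giving `H^{⊗ (n+2)} = (H ⊗ H) ⊗ H^{⊗ n}`. -/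
def headE (n : ℕ) : (Fin n → ℤ) × (ℤ × ℤ) ≃ (Fin (n + 2) → ℤ) where
  toFun p := Fin.cons p.2.1 (Fin.cons p.2.2 p.1 : Fin (n + 1) → ℤ)
  invFun x := (Fin.tail (Fin.tail x), (x 0, x 1))
  left_inv _ := rfl
  right_inv x := by
    change Fin.cons (x 0) (Fin.cons (Fin.tail x 0) (Fin.tail (Fin.tail x))) = x
    rw [Fin.cons_self_tail, Fin.cons_self_tail]

/-- `braid T n k` is the operator `I^{⊗ k} ⊗ T ⊗ I^{⊗ (n-k-2)}` on `H^{⊗ n}`, for `k + 2 ≤ n`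
(positions are counted from `0`; the value is `0` for other `k`). -/
noncomputable def braid (T : Ell2 (ℤ × ℤ) →L[ℂ] Ell2 (ℤ × ℤ)) :
    (n k : ℕ) → (HPow n →L[ℂ] HPow n)
  | 0, _ => 0
  | 1, 0 => 0
  | n + 2, 0 => amp (headE n) T
  | n + 1, k + 1 => amp (consE n) (braid T n k)

/-- `R^{(n)} = I + T₁ + T₁T₂ + ⋯ + T₁T₂⋯T_{n-1}`. -/
noncomputable def opR (T : Ell2 (ℤ × ℤ) →L[ℂ] Ell2 (ℤ × ℤ)) (n : ℕ) : HPow n →L[ℂ] HPow n :=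
  ∑ j ∈ Finset.range n, ((List.range j).map (braid T n)).prod

/-- The `T`-symmetrizator: `P^{(0)} = I` and `P^{(n+1)} = (I ⊗ P^{(n)}) R^{(n+1)}`. -/
noncomputable def opP (T : Ell2 (ℤ × ℤ) →L[ℂ] Ell2 (ℤ × ℤ)) : (n : ℕ) → (HPow n →L[ℂ] HPow n)
  | 0 => 1
  | n + 1 => amp (consE n) (opP T n) * opR T (n + 1)

/-- Selfadjoint Yang-Baxter-Hecke operators on `ℓ²(ℤ) ⊗ ℓ²(ℤ) = ℓ²(ℤ × ℤ)`. -/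
structure IsYangBaxterHecke (T : Ell2 (ℤ × ℤ) →L[ℂ] Ell2 (ℤ × ℤ)) : Prop where
  isSelfAdjoint : IsSelfAdjoint T
  /-- `T ≥ -I` -/
  ge_neg_one : (T + 1).IsPositive
  /-- `T₁ T₂ T₁ = T₂ T₁ T₂` on `H ⊗ H ⊗ H`, with `T₁ = T ⊗ I` and `T₂ = I ⊗ T` -/
  yang_baxter : braid T 3 0 * braid T 3 1 * braid T 3 0 = braid T 3 1 * braid T 3 0 * braid T 3 1
  hecke : ∃ q : ℝ, -1 ≤ q ∧ T * T = ((q - 1 : ℝ) : ℂ) • T + (q : ℂ) • 1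

variable {T : Ell2 (ℤ × ℤ) →L[ℂ] Ell2 (ℤ × ℤ)}

theorem amp_amp {α β β' γ δ ε : Type} (e₁ : β × α ≃ γ) (e₂ : δ × γ ≃ ε) (e₃ : β' × α ≃ ε)
    (f : δ → β → β') (h : ∀ d b a, e₃ (f d b, a) = e₂ (d, e₁ (b, a)))
    (A : Ell2 α →L[ℂ] Ell2 α) : amp e₂ (amp e₁ A) = amp e₃ A := by
  have hs : ∀ d b (ξ : Ell2 ε), slice e₁ b (slice e₂ d ξ) = slice e₃ (f d b) ξ := fun d b ξ => by
    ext a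
    exact congrArg ξ (h d b a).symm
  ext1 ξ
  refine ext_slice e₂ fun d => ext_slice e₁ fun b => ?_
  rw [slice_amp, slice_amp, hs, hs, slice_amp]

/-- `T₁` commutes with `I ⊗ I ⊗ A`. -/
theorem head_comm (n : ℕ) (A : HPow n →L[ℂ] HPow n) :
    Commute (amp (headE n) T) (amp (consE (n + 1)) (amp (consE n) A)) := by
  rw [amp_amp (consE n) (consE (n + 1)) ((Equiv.prodComm (ℤ × ℤ) (Fin n → ℤ)).trans (headE n))
    (fun i j => (i, j)) (fun _ _ _ => rfl)]
  exact (amp_comm ((Equiv.prodComm (ℤ × ℤ) (Fin n → ℤ)).trans (headE n)) A T).symm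

/-- `((i₁, …, iₙ), (a, b, c)) ↦ (a, b, c, i₁, …, iₙ)` -/
def head3E (n : ℕ) : (Fin n → ℤ) × (Fin 3 → ℤ) ≃ (Fin (n + 3) → ℤ) where
  toFun p := Fin.cons (p.2 0)
    (Fin.cons (p.2 1) (Fin.cons (p.2 2) p.1 : Fin (n + 1) → ℤ) : Fin (n + 2) → ℤ)
  invFun x := (Fin.tail (Fin.tail (Fin.tail x)), ![x 0, x 1, x 2])
  left_inv p := by
    refine Prod.ext rfl ?_
    funext i
    fin_cases i <;> rfl
  right_inv x := by
    change Fin.cons (x 0) (Fin.cons (Fin.tail x 0)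
      (Fin.cons (Fin.tail (Fin.tail x) 0) (Fin.tail (Fin.tail (Fin.tail x))))) = x
    rw [Fin.cons_self_tail, Fin.cons_self_tail, Fin.cons_self_tail]

/-- `((i, z), (a, b)) ↦ (i, a, b, z)` -/
def midE (n : ℕ) : (ℤ × (Fin n → ℤ)) × (ℤ × ℤ) ≃ (Fin (n + 3) → ℤ) :=
  ((Equiv.prodAssoc _ _ _).trans ((Equiv.refl ℤ).prodCongr (headE n))).trans (consE (n + 2))

theorem head_braid (hT : IsYangBaxterHecke T) (n : ℕ) :
    amp (headE (n + 1)) T * amp (consE (n + 2)) (amp (headE n) T) * amp (headE (n + 1)) T =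
      amp (consE (n + 2)) (amp (headE n) T) * amp (headE (n + 1)) T *
        amp (consE (n + 2)) (amp (headE n) T) := by
  have h1 : amp (headE (n + 1)) T = amp (head3E n) (braid T 3 0) :=
    (amp_amp (headE 1) (head3E n) (headE (n + 1)) (fun z b => Fin.cons (b 0) z)
      (fun _ _ _ => rfl) T).symm
  have h2 : amp (consE (n + 2)) (amp (headE n) T) = amp (midE n) T :=
    amp_amp (headE n) (consE (n + 2)) (midE n) (fun i z => (i, z)) (fun _ _ _ => rfl) T
  have h3 : braid T 3 1 = amp (midE 0) T :=
    amp_amp (headE 0) (consE 2) (midE 0) (fun i z => (i, z)) (fun _ _ _ => rfl) T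
  have h4 : amp (head3E n) (braid T 3 1) = amp (midE n) T := by
    rw [h3]
    exact amp_amp (midE 0) (head3E n) (midE n) (fun z i => (i.1, z)) (fun _ _ _ => rfl) T
  rw [h2, ← h4, h1]
  simp only [← amp_mul]
  rw [hT.yang_baxter]

theorem opR_one : opR T 1 = 1 := by simp [opR]

theorem opR_succ (n : ℕ) :
    opR T (n + 2) = 1 + amp (headE n) T * amp (consE (n + 1)) (opR T (n + 1)) := by
  have h : ∀ j, ((List.range (j + 1)).map (braid T (n + 2))).prod =
      amp (headE n) T * amp (consE (n + 1)) ((List.range j).map (braid T (n + 1))).prod := fun j => by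
    rw [List.range_succ_eq_map, List.map_cons, List.prod_cons]
    congr 1
    change _ = ampHom (consE (n + 1)) _
    rw [map_list_prod, List.map_map, List.map_map]
    rfl
  change _ = 1 + _ * ampHom (consE (n + 1)) _
  rw [opR, Finset.sum_range_succ', opR, map_sum, Finset.mul_sum]
  refine (add_comm _ _).trans (congrArg₂ _ rfl ?_)
  exact Finset.sum_congr rfl fun j _ => h j

theorem braid_star (hT : IsYangBaxterHecke T) : ∀ n k, star (braid T n k) = braid T n k
  | 0, _ => by simp [braid]
  | 1, 0 => by simp [braid]
  | n + 2, 0 => by rw [braid, ← amp_star, hT.isSelfAdjoint.star_eq]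
  | n + 1, k + 1 => by rw [braid, ← amp_star, braid_star hT n k]

/-- The relation `(T₁ - q) (1 + T₁) = 0`, in the form in which it is used. -/
theorem head_mul (q : ℂ) (hq : T * T = (q - 1) • T + q • 1) (n : ℕ) :
    amp (headE n) T * amp (headE n) T = (q - 1) • amp (headE n) T + q • 1 := by
  rw [← amp_mul, hq, amp_add, amp_smul, amp_smul, amp_one]

theorem head_mul_opR (hT : IsYangBaxterHecke T) (q : ℂ) (hq : T * T = (q - 1) • T + q • 1) :
    ∀ n, amp (headE n) T * (amp (consE (n + 1)) (opR T (n + 1)) * opR T (n + 2)) =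
      q • (amp (consE (n + 1)) (opR T (n + 1)) * opR T (n + 2))
  | 0 => by
    rw [opR_succ, opR_one, amp_one, one_mul, mul_one, mul_add, mul_one, head_mul q hq]
    module
  | n + 1 => by
    have ih := congrArg (amp (consE (n + 2))) (head_mul_opR hT q hq n)
    rw [amp_smul, amp_mul, amp_mul] at ih
    have hu := head_comm (T := T) (n + 1) (opR T (n + 1))
    have hτ := head_mul q hq (n + 1)
    have hb := head_braid hT n
    rw [opR_succ (n + 1), opR_succ n]
    rw [opR_succ n] at ih
    simp only [amp_add, amp_mul, amp_one] at ih ⊢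
    generalize amp (consE (n + 2)) (amp (consE (n + 1)) (opR T (n + 1))) = u at *
    generalize amp (consE (n + 2)) (amp (headE n) T) = σ at *
    generalize amp (headE (n + 1)) T = τ at *
    have e1 : (1 + σ * u) * (1 + τ * (1 + σ * u)) =
        (1 + τ) * (1 + σ * u) + σ * τ * (u * (1 + σ * u)) := by
      have : σ * u * (τ * (1 + σ * u)) = σ * τ * (u * (1 + σ * u)) := by
        rw [mul_assoc σ u, ← mul_assoc u τ, ← hu.eq]
        simp only [mul_assoc]
      rw [add_mul 1 (σ * u), one_mul, mul_add (σ * u), mul_one, this, add_mul 1 τ, one_mul]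
      abel
    have e2 : τ * (1 + τ) = q • (1 + τ) := by
      rw [mul_add, mul_one, hτ]
      module
    rw [e1, mul_add, ← mul_assoc τ (1 + τ), e2, smul_mul_assoc, smul_add, ← mul_assoc τ,
      ← mul_assoc τ, hb, mul_assoc (σ * τ), ih, mul_smul_comm]

theorem braid_mul_opP (hT : IsYangBaxterHecke T) (q : ℂ) (hq : T * T = (q - 1) • T + q • 1) :
    ∀ n k, k + 1 < n → braid T n k * opP T n = q • opP T n
  | 0, _, h => by omega
  | 1, _, h => by omega
  | n + 2, 0, _ => by
    have hu := head_comm (T := T) n (opP T n)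
    rw [opP, opP, amp_mul, braid, mul_assoc, ← mul_assoc, hu.eq, mul_assoc,
      head_mul_opR hT q hq n, mul_smul_comm]
  | n + 2, k + 1, h => by
    rw [opP, braid, ← mul_assoc, ← amp_mul, braid_mul_opP hT q hq (n + 1) k (by omega), amp_smul,
      smul_mul_assoc]

/-- The `q`-factorial. -/
noncomputable def qfac (q : ℝ) (n : ℕ) : ℝ := ∏ m ∈ Finset.range n, ∑ i ∈ Finset.range (m + 1), q ^ i

theorem qfac_nonneg {q : ℝ} (hq : -1 ≤ q) (n : ℕ) : 0 ≤ qfac q n := by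
  refine Finset.prod_nonneg fun m _ => ?_
  rcases eq_or_lt_of_le hq with rfl | h
  · rw [neg_one_geom_sum]
    split_ifs <;> norm_num
  · exact (geom_sum_pos' (by linarith) (by omega)).le

theorem list_mul_eq (hT : IsYangBaxterHecke T) (q : ℂ) {n : ℕ} {B : Type} [Ring B] [Algebra ℂ B]
    (φ : (HPow n →L[ℂ] HPow n) →ₐ[ℂ] B) (Y : B)
    (hY : ∀ k, k + 1 < n → φ (braid T n k) * Y = q • Y) (l : List ℕ) (hl : ∀ k ∈ l, k + 1 < n) :
    φ (l.map (braid T n)).prod * Y = q ^ l.length • Y ∧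
      φ (star (l.map (braid T n)).prod) * Y = q ^ l.length • Y := by
  induction l with
  | nil => simp
  | cons k l ih =>
    obtain ⟨h1, h2⟩ := ih fun j hj => hl j (List.mem_cons_of_mem _ hj)
    have hk := hY k (hl k List.mem_cons_self)
    rw [List.map_cons, List.prod_cons, star_mul, braid_star hT, map_mul, map_mul, mul_assoc,
      mul_assoc, h1, hk, mul_smul_comm, mul_smul_comm, hk, h2, smul_smul, smul_smul,
      List.length_cons, pow_succ, mul_comm q]
    exact ⟨rfl, rfl⟩

theorem opR_mul_eq (hT : IsYangBaxterHecke T) (q : ℂ) {n : ℕ} {B : Type} [Ring B] [Algebra ℂ B]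
    (φ : (HPow n →L[ℂ] HPow n) →ₐ[ℂ] B) (Y : B)
    (hY : ∀ k, k + 1 < n → φ (braid T n k) * Y = q • Y) :
    φ (opR T n) * Y = (∑ i ∈ Finset.range n, q ^ i) • Y ∧
      φ (star (opR T n)) * Y = (∑ i ∈ Finset.range n, q ^ i) • Y := by
  rw [opR, star_sum, map_sum, map_sum, Finset.sum_mul, Finset.sum_mul, Finset.sum_smul]
  have h : ∀ j ∈ Finset.range n, _ := fun j hj => list_mul_eq hT q φ Y hY (List.range j)
    (fun k hk => by
      have h1 := List.mem_range.1 hk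
      have h2 := Finset.mem_range.1 hj
      omega)
  exact ⟨Finset.sum_congr rfl fun j hj => by rw [(h j hj).1, List.length_range],
    Finset.sum_congr rfl fun j hj => by rw [(h j hj).2, List.length_range]⟩

theorem opP_mul_eq (hT : IsYangBaxterHecke T) (q : ℝ) (n : ℕ) {B : Type} [Ring B] [Algebra ℂ B]
    (φ : (HPow n →L[ℂ] HPow n) →ₐ[ℂ] B) (Y : B)
    (hY : ∀ k, k + 1 < n → φ (braid T n k) * Y = (q : ℂ) • Y) :
    φ (opP T n) * Y = (qfac q n : ℂ) • Y ∧ φ (star (opP T n)) * Y = (qfac q n : ℂ) • Y := by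
  induction n with
  | zero => simp [opP, qfac]
  | succ n ih =>
    obtain ⟨h1, h2⟩ := opR_mul_eq hT q φ Y hY
    obtain ⟨h3, h4⟩ := ih (φ.comp (ampHom (consE n) : _ →ₐ[ℂ] _)) fun k hk => by
      rcases n with _ | n
      · omega
      · exact hY (k + 1) (by omega)
    change φ (amp (consE n) (opP T n)) * Y = _ at h3
    change φ (amp (consE n) (star (opP T n))) * Y = _ at h4
    have hf : (qfac q (n + 1) : ℂ) =
        (∑ i ∈ Finset.range (n + 1), (q : ℂ) ^ i) * (qfac q n : ℂ) := by
      rw [qfac, Finset.prod_range_succ, ← qfac, mul_comm]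
      push_cast
      rfl
    rw [opP, star_mul, ← amp_star, map_mul, map_mul, mul_assoc, mul_assoc, h1, h4, mul_smul_comm,
      mul_smul_comm, h2, h3, smul_smul, smul_smul, hf]
    exact ⟨rfl, by rw [mul_comm]⟩

/-- `P^{(n)}` is selfadjoint and a nonnegative multiple of a projection. -/
theorem opP_spec (hT : IsYangBaxterHecke T) (n : ℕ) :
    star (opP T n) = opP T n ∧
      ∃ c : ℝ, 0 ≤ c ∧ opP T n * opP T n = (c : ℂ) • opP T n ∧ (c = 0 → opP T n = 0) := by
  obtain ⟨q, hq, hh⟩ := hT.hecke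
  have hh' : T * T = ((q : ℂ) - 1) • T + (q : ℂ) • 1 := by rw [hh]; push_cast; rfl
  obtain ⟨h1, h2⟩ := opP_mul_eq hT q n (AlgHom.id ℂ _) (opP T n) (braid_mul_opP hT q hh' n)
  change opP T n * opP T n = _ at h1
  change star (opP T n) * opP T n = _ at h2
  have h0 : qfac q n = 0 → opP T n = 0 := fun h => by
    rw [h, Complex.ofReal_zero, zero_smul] at h2
    exact CStarRing.star_mul_self_eq_zero_iff _ |>.1 h2
  refine ⟨?_, qfac q n, qfac_nonneg hq n, h1, h0⟩
  by_cases h : qfac q n = 0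
  · rw [h0 h, star_zero]
  · have h3 := congrArg star h2
    rw [star_mul, star_star, h2, star_smul, Complex.star_def, Complex.conj_ofReal] at h3
    exact (smul_right_injective _ (Complex.ofReal_ne_zero.2 h) h3).symm

theorem inner_opP_comm (hT : IsYangBaxterHecke T) (n : ℕ) (ξ η : HPow n) :
    inner ℂ (opP T n ξ) η = inner ℂ ξ (opP T n η) := by
  conv_lhs => rw [← (opP_spec hT n).1]
  rw [ContinuousLinearMap.star_eq_adjoint, ContinuousLinearMap.adjoint_inner_left]

theorem norm_opP_sq (hT : IsYangBaxterHecke T) (n : ℕ) :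
    ∃ c : ℝ, 0 ≤ c ∧ (c = 0 → opP T n = 0) ∧
      ∀ ξ, (‖opP T n ξ‖ : ℂ) ^ 2 = c * inner ℂ ξ (opP T n ξ) := by
  obtain ⟨c, hc, h, h0⟩ := (opP_spec hT n).2
  refine ⟨c, hc, h0, fun ξ => ?_⟩
  have h1 : opP T n (opP T n ξ) = (c : ℂ) • opP T n ξ := congrArg (fun A => A ξ) h
  refine (inner_self_eq_norm_sq_to_K (𝕜 := ℂ) (opP T n ξ)).symm.trans ?_
  rw [inner_opP_comm hT, h1, inner_smul_right]

/-- `P^{(n)} ≥ 0`. -/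
theorem opP_nonneg (hT : IsYangBaxterHecke T) (n : ℕ) (ξ : HPow n) :
    0 ≤ (inner ℂ ξ (opP T n ξ)).re := by
  obtain ⟨c, hc, h0, h⟩ := norm_opP_sq hT n
  rcases eq_or_lt_of_le hc with h' | h'
  · rw [h0 h'.symm]; simp
  · have h1 := congrArg Complex.re (h ξ)
    rw [Complex.re_ofReal_mul, ← Complex.ofReal_pow, Complex.ofReal_re] at h1
    by_contra! h2
    nlinarith [sq_nonneg ‖opP T n ξ‖]

/-- `P^{(n+1)} ≤ C (I ⊗ P^{(n)})` for some constant `C`. -/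
theorem opP_succ_le (hT : IsYangBaxterHecke T) (n : ℕ) :
    ∃ C : ℝ, 0 ≤ C ∧ ∀ ξ : HPow (n + 1), (inner ℂ ξ (opP T (n + 1) ξ)).re ≤
      C * (inner ℂ ξ (amp (consE n) (opP T n) ξ)).re := by
  obtain ⟨c, hc, h0, h⟩ := norm_opP_sq hT (n + 1)
  obtain ⟨d, hd, h1, -⟩ := (opP_spec hT n).2
  rcases eq_or_lt_of_le hc with h' | h'
  · exact ⟨0, le_rfl, fun ξ => by rw [h0 h'.symm]; simp⟩
  refine ⟨c⁻¹ * (‖star (opR T (n + 1))‖ ^ 2 * d), by positivity, fun ξ => ?_⟩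
  have hQ : star (amp (consE n) (opP T n)) = amp (consE n) (opP T n) := by
    rw [← amp_star, (opP_spec hT n).1]
  have hP : opP T (n + 1) = star (opR T (n + 1)) * amp (consE n) (opP T n) := by
    rw [← (opP_spec hT (n + 1)).1, opP, star_mul, hQ]
  have e1 := congrArg Complex.re (h ξ)
  rw [Complex.re_ofReal_mul, ← Complex.ofReal_pow, Complex.ofReal_re] at e1
  have e2 : ‖opP T (n + 1) ξ‖ ≤
      ‖star (opR T (n + 1))‖ * ‖amp (consE n) (opP T n) ξ‖ := by
    rw [hP]
    exact (star (opR T (n + 1))).le_opNorm (amp (consE n) (opP T n) ξ)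
  have e3 : ‖amp (consE n) (opP T n) ξ‖ ^ 2 =
      d * (inner ℂ ξ (amp (consE n) (opP T n) ξ)).re := by
    have e4 : amp (consE n) (opP T n) (amp (consE n) (opP T n) ξ) =
        (d : ℂ) • amp (consE n) (opP T n) ξ := by
      have := congrArg (fun A => A ξ) (congrArg (amp (consE n)) h1)
      rwa [amp_mul, amp_smul] at this
    have e5 := inner_self_eq_norm_sq_to_K (𝕜 := ℂ) (amp (consE n) (opP T n) ξ)
    rw [← ContinuousLinearMap.adjoint_inner_right, ← ContinuousLinearMap.star_eq_adjoint, hQ, e4,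
      inner_smul_right] at e5
    have e6 := congrArg Complex.re e5
    rw [Complex.re_ofReal_mul] at e6
    rw [e6]
    norm_cast
  have e7 : ‖opP T (n + 1) ξ‖ ^ 2 ≤ ‖star (opR T (n + 1))‖ ^ 2 *
      (d * (inner ℂ ξ (amp (consE n) (opP T n) ξ)).re) := by
    rw [← e3, ← mul_pow]
    gcongr
  rw [e1] at e7
  rw [mul_assoc, mul_assoc, ← inv_mul_le_iff₀ (inv_pos.2 h'), inv_inv]
  exact e7

end Braiding

section FockSpace

variable {T : Ell2 (ℤ × ℤ) →L[ℂ] Ell2 (ℤ × ℤ)}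

/-- The space `H^{⊗ n}`, to be equipped with the `T`-deformed pre-inner product. -/
def PreFock (_hT : IsYangBaxterHecke T) (n : ℕ) : Type := HPow n

variable (hT : IsYangBaxterHecke T)

noncomputable instance (n : ℕ) : AddCommGroup (PreFock hT n) := inferInstanceAs (AddCommGroup (HPow n))

noncomputable instance (n : ℕ) : Module ℂ (PreFock hT n) := inferInstanceAs (Module ℂ (HPow n))

/-- The `T`-deformed pre-inner product `⟨ξ, η⟩_T = ⟨ξ, P^{(n)} η⟩`. -/
@[reducible]
noncomputable def preFockCore (n : ℕ) : PreInnerProductSpace.Core ℂ (PreFock hT n) where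
  inner ξ η := (InnerProductSpace.toInner : Inner ℂ (HPow n)).inner ξ (opP T n η)
  conj_inner_symm ξ η :=
    (inner_conj_symm (E := HPow n) (opP T n ξ) η).trans (inner_opP_comm hT n ξ η)
  re_inner_nonneg ξ := opP_nonneg hT n ξ
  add_left ξ η ζ := inner_add_left (𝕜 := ℂ) (E := HPow n) ξ η (opP T n ζ)
  smul_left ξ η r := inner_smul_left (𝕜 := ℂ) (E := HPow n) ξ (opP T n η) r

noncomputable instance (n : ℕ) : SeminormedAddCommGroup (PreFock hT n) :=
  @InnerProductSpace.Core.toSeminormedAddCommGroup ℂ _ _ _ _ (preFockCore hT n)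

noncomputable instance (n : ℕ) : InnerProductSpace ℂ (PreFock hT n) :=
  InnerProductSpace.ofCore (preFockCore hT n)

theorem preFock_norm_sq (n : ℕ) (ξ : PreFock hT n) :
    ‖ξ‖ ^ 2 = (@inner ℂ (HPow n) _ ξ (opP T n ξ)).re :=
  norm_sq_eq_re_inner (𝕜 := ℂ) ξ

/-- The `n`-particle space `H_T^n`: the Hilbert space obtained from `H^{⊗ n}` and the `T`-deformed
pre-inner product by dividing out the vectors of length zero and completing. -/
abbrev NSpace (n : ℕ) : Type := UniformSpace.Completion (PreFock hT n)

/-- The `T`-deformed Fock space, the Hilbert space direct sum of the `H_T^n`. -/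
abbrev FockSpace : Type := lp (fun n => NSpace hT n) 2

theorem tens_le (hT : IsYangBaxterHecke T) (n : ℕ) : ∃ C : ℝ, 0 ≤ C ∧ ∀ (f : Ell2 ℤ) (ξ : HPow n),
    (inner ℂ (tens (consE n) f ξ) (opP T (n + 1) (tens (consE n) f ξ))).re ≤
      C * ‖f‖ ^ 2 * (inner ℂ ξ (opP T n ξ)).re := by
  obtain ⟨C, hC, h⟩ := opP_succ_le hT n
  refine ⟨C, hC, fun f ξ => (h (tens (consE n) f ξ)).trans_eq ?_⟩
  rw [amp_tens, inner_tens, mul_assoc]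
  refine congrArg (C * ·) ?_
  have h1 : inner ℂ f f = ((‖f‖ ^ 2 : ℝ) : ℂ) := by
    rw [Complex.ofReal_pow]
    exact inner_self_eq_norm_sq_to_K f
  rw [h1, Complex.re_ofReal_mul]

/-- `ξ ↦ f ⊗ ξ` as a bounded map for the `T`-deformed seminorms. -/
noncomputable def preCreate (f : Ell2 ℤ) (n : ℕ) : PreFock hT n →L[ℂ] PreFock hT (n + 1) :=
  LinearMap.mkContinuousOfExistsBound
    { toFun := fun ξ => tens (consE n) f ξ
      map_add' := map_add (tens (consE n) f)
      map_smul' := map_smul (tens (consE n) f) } <| by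
    obtain ⟨C, hC, h⟩ := tens_le hT n
    refine ⟨Real.sqrt C * ‖f‖, fun ξ => ?_⟩
    refine (sq_le_sq₀ (norm_nonneg _) (by positivity)).1 ?_
    rw [preFock_norm_sq, mul_pow, mul_pow, Real.sq_sqrt hC, preFock_norm_sq]
    exact h f ξ

/-- The creation operator `a†(f) : H_T^n → H_T^{n+1}`, induced by `ξ ↦ f ⊗ ξ`. -/
noncomputable def create (f : Ell2 ℤ) (n : ℕ) : NSpace hT n →L[ℂ] NSpace hT (n + 1) :=
  (preCreate hT f n).completion

/-- The annihilation operator `a(f) : H_T^{n+1} → H_T^n`, the adjoint of `a†(f)`. -/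
noncomputable def annihilate (f : Ell2 ℤ) (n : ℕ) : NSpace hT (n + 1) →L[ℂ] NSpace hT n :=
  (create hT f n).adjoint

/-- The finite particle vectors: the algebraic direct sum of the `H_T^n`. -/
abbrev FiniteParticle : Type := DirectSum ℕ fun n => NSpace hT n

/-- `a†(f)` on the finite particle vectors. -/
noncomputable def createFin (f : Ell2 ℤ) : Module.End ℂ (FiniteParticle hT) :=
  DirectSum.toModule ℂ ℕ (FiniteParticle hT) fun n =>
    DirectSum.lof ℂ ℕ (fun n => NSpace hT n) (n + 1) ∘ₗ (create hT f n).toLinearMap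

/-- `a(f)` on the finite particle vectors; it kills the vacuum. -/
noncomputable def annihilateFin (f : Ell2 ℤ) : Module.End ℂ (FiniteParticle hT) :=
  DirectSum.toModule ℂ ℕ (FiniteParticle hT) fun n =>
    match n with
    | 0 => 0
    | n + 1 => DirectSum.lof ℂ ℕ (fun n => NSpace hT n) n ∘ₗ (annihilate hT f n).toLinearMap

/-- `a^♯(e_i)`, where `♯ = †` if `d = true` and `♯` is void if `d = false`. -/
noncomputable def sharp (d : Bool) (i : ℤ) : Module.End ℂ (FiniteParticle hT) :=
  if d then createFin hT (lp.single 2 i 1) else annihilateFin hT (lp.single 2 i 1)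

/-- The word `a^♯(e_{i₁}) a^♯(e_{i₂}) ⋯ a^♯(e_{i_r})` on the finite particle vectors. -/
noncomputable def word (w : List (Bool × ℤ)) : Module.End ℂ (FiniteParticle hT) :=
  (w.map fun p => sharp hT p.1 p.2).prod

/-- The part of a word that maps `H_T^n` to `H_T^m`. -/
noncomputable def wordBlock (m : ℕ) (w : List (Bool × ℤ)) (n : ℕ) : NSpace hT n →ₗ[ℂ] NSpace hT m :=
  DirectSum.component ℂ ℕ (fun n => NSpace hT n) m ∘ₗ word hT w ∘ₗ
    DirectSum.lof ℂ ℕ (fun n => NSpace hT n) n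

theorem component_createFin_zero (f : Ell2 ℤ) (x : FiniteParticle hT) : createFin hT f x 0 = 0 := by
  induction x using DirectSum.induction_on with
  | zero => simp
  | of k x =>
    change (DirectSum.toModule ℂ ℕ (FiniteParticle hT) _)
      (DirectSum.lof ℂ ℕ (fun n => NSpace hT n) k x) 0 = 0
    rw [DirectSum.toModule_lof]
    exact DirectSum.of_eq_of_ne _ _ _ (by omega)
  | add x y hx hy => rw [map_add, DirectSum.add_apply, hx, hy, add_zero]

theorem component_createFin_succ (f : Ell2 ℤ) (m : ℕ) (x : FiniteParticle hT) :
    createFin hT f x (m + 1) = create hT f m (x m) := by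
  induction x using DirectSum.induction_on with
  | zero => simp
  | of k x =>
    change (DirectSum.toModule ℂ ℕ (FiniteParticle hT) _)
      (DirectSum.lof ℂ ℕ (fun n => NSpace hT n) k x) (m + 1) = _
    rw [DirectSum.toModule_lof]
    change DirectSum.of (fun n => NSpace hT n) (k + 1) (create hT f k x) (m + 1) = _
    rcases eq_or_ne m k with rfl | h
    · rw [DirectSum.of_eq_same, DirectSum.of_eq_same]
    · rw [DirectSum.of_eq_of_ne _ _ _ (by omega), DirectSum.of_eq_of_ne _ _ _ h, map_zero]
  | add x y hx hy => rw [map_add, DirectSum.add_apply, hx, hy, DirectSum.add_apply, map_add]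

theorem component_annihilateFin (f : Ell2 ℤ) (m : ℕ) (x : FiniteParticle hT) :
    annihilateFin hT f x m = annihilate hT f m (x (m + 1)) := by
  induction x using DirectSum.induction_on with
  | zero => simp
  | of k x =>
    change (DirectSum.toModule ℂ ℕ (FiniteParticle hT) _)
      (DirectSum.lof ℂ ℕ (fun n => NSpace hT n) k x) m = _
    rw [DirectSum.toModule_lof]
    rcases k with _ | k
    · rw [DirectSum.of_eq_of_ne _ _ _ (by omega), map_zero]
      rfl
    change DirectSum.of (fun n => NSpace hT n) k (annihilate hT f k x) m = _
    rcases eq_or_ne m k with rfl | h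
    · rw [DirectSum.of_eq_same, DirectSum.of_eq_same]
    · rw [DirectSum.of_eq_of_ne _ _ _ h, DirectSum.of_eq_of_ne _ _ _ (by omega), map_zero]
  | add x y hx hy => rw [map_add, DirectSum.add_apply, hx, hy, DirectSum.add_apply, map_add]

theorem wordBlock_bound (m : ℕ) (w : List (Bool × ℤ)) (n : ℕ) :
    ∃ C : ℝ, ∀ x, ‖wordBlock hT m w n x‖ ≤ C * ‖x‖ := by
  have key : ∀ {k l : ℕ} (A : NSpace hT k →L[ℂ] NSpace hT l) (w : List (Bool × ℤ)),
      (∃ C : ℝ, ∀ x, ‖wordBlock hT k w n x‖ ≤ C * ‖x‖) →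
      ∃ C : ℝ, ∀ x, ‖A (wordBlock hT k w n x)‖ ≤ C * ‖x‖ := by
    rintro k l A w ⟨C, hC⟩
    refine ⟨‖A‖ * C, fun x => (A.le_opNorm _).trans ?_⟩
    rw [mul_assoc]
    exact mul_le_mul_of_nonneg_left (hC x) (norm_nonneg _)
  induction w generalizing m with
  | nil =>
    refine ⟨1, fun x => ?_⟩
    rw [one_mul]
    change ‖DirectSum.of (fun n => NSpace hT n) n x m‖ ≤ _
    rcases eq_or_ne m n with rfl | h
    · rw [DirectSum.of_eq_same]
    · rw [DirectSum.of_eq_of_ne _ _ _ h, norm_zero]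
      exact norm_nonneg _
  | cons p w ih =>
    have hp : ∀ x, wordBlock hT m (p :: w) n x =
        sharp hT p.1 p.2 (word hT w (DirectSum.lof ℂ ℕ (fun n => NSpace hT n) n x)) m :=
      fun x => rfl
    obtain ⟨d, i⟩ := p
    rcases d with _ | _
    · obtain ⟨C, hC⟩ := key (annihilate hT (lp.single 2 i 1) m) w (ih (m + 1))
      refine ⟨C, fun x => ?_⟩
      rw [hp]
      exact (congrArg norm (component_annihilateFin hT _ _ _)).trans_le (hC x)
    · rcases m with _ | m
      · refine ⟨0, fun x => ?_⟩
        rw [hp, zero_mul]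
        exact (norm_eq_zero.2 (component_createFin_zero hT _ _)).le
      · obtain ⟨C, hC⟩ := key (create hT (lp.single 2 i 1) m) w (ih m)
        refine ⟨C, fun x => ?_⟩
        rw [hp]
        exact (congrArg norm (component_createFin_succ hT _ _ _)).trans_le (hC x)

/-- The bounded operator `E^m a^♯(e_{i₁}) a^♯(e_{i₂}) ⋯ a^♯(e_{i_r}) E^n` on the `T`-deformed Fock
space, `E^n` being the orthogonal projection onto `H_T^n`. -/
noncomputable def cutWord (m : ℕ) (w : List (Bool × ℤ)) (n : ℕ) :
    FockSpace hT →L[ℂ] FockSpace hT :=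
  lp.singleContinuousLinearMap ℂ (fun n => NSpace hT n) 2 m ∘L
    (wordBlock hT m w n).mkContinuousOfExistsBound (wordBlock_bound hT m w n) ∘L
      lp.evalCLM ℂ (fun n => NSpace hT n) 2 n

/-- The `C*`-algebra `𝔈_T` generated by the identity and by the operators
`E^m a^♯(e_{i₁}) ⋯ a^♯(e_{i_r}) E^n`. -/
noncomputable def algE : StarSubalgebra ℂ (FockSpace hT →L[ℂ] FockSpace hT) :=
  (StarAlgebra.adjoin ℂ {X | ∃ m w n, X = cutWord hT m w n}).topologicalClosure

instance : IsClosed (algE hT : Set (FockSpace hT →L[ℂ] FockSpace hT)) :=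
  StarSubalgebra.isClosed_topologicalClosure _

end FockSpace

section Shift

/-- The unitary on `ℓ²(α)` with `δ_a ↦ δ_(a+1)`. For `α = ℤ` it is the shift `U : e_i ↦ e_{i+1}`;
for `α = ℤ × ℤ` and `α = ℤⁿ`, where `1 = (1, …, 1)`, it is `U ⊗ U` and `U^{⊗ n}`. -/
noncomputable def shift (α : Type) [AddGroup α] [One α] : Ell2 α ≃ₗᵢ[ℂ] Ell2 α :=
  reindex (Equiv.addRight (1 : α))

/-- `T` commutes with `U ⊗ U`, where `U e_i = e_{i+1}`. -/
def CommutesWithShift (T : Ell2 (ℤ × ℤ) →L[ℂ] Ell2 (ℤ × ℤ)) : Prop :=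
  ∀ ξ, T (shift (ℤ × ℤ) ξ) = shift (ℤ × ℤ) (T ξ)

variable {T : Ell2 (ℤ × ℤ) →L[ℂ] Ell2 (ℤ × ℤ)}

theorem amp_shift {α β γ : Type} [AddGroup α] [One α] [AddGroup β] [One β] [AddGroup γ] [One γ]
    (e : β × α ≃ γ) (he : ∀ p, e (p - 1) = e p - 1) (A : Ell2 α →L[ℂ] Ell2 α)
    (hA : ∀ ξ, A (shift α ξ) = shift α (A ξ)) (ξ : Ell2 γ) :
    amp e A (shift γ ξ) = shift γ (amp e A ξ) := by
  have hs : ∀ (b : β) (η : Ell2 γ), slice e b (shift γ η) = shift α (slice e (b - 1) η) :=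
    fun b η => by
      ext a
      change η (e (b, a) + -1) = η (e (b - 1, a + -1))
      rw [← sub_eq_add_neg, ← sub_eq_add_neg, ← he]
      rfl
  refine ext_slice e fun b => ?_
  rw [slice_amp, hs, hA, hs, slice_amp]

theorem braid_shift (hU : CommutesWithShift T) :
    ∀ n k (ξ : HPow n), braid T n k (shift _ ξ) = shift _ (braid T n k ξ)
  | 0, _, ξ => (map_zero (shift (Fin 0 → ℤ))).symm
  | 1, 0, ξ => (map_zero (shift (Fin 1 → ℤ))).symm
  | n + 2, 0, ξ => amp_shift (headE n) (fun p => by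
      funext i
      refine Fin.cases rfl (fun i => Fin.cases rfl (fun i => rfl) i) i) T hU ξ
  | n + 1, k + 1, ξ => by
    rw [braid]
    exact amp_shift (consE n) (fun p => by
      funext i
      refine Fin.cases rfl (fun i => rfl) i) _ (braid_shift hU n k) ξ

theorem opR_shift (hU : CommutesWithShift T) (n : ℕ) (ξ : HPow n) :
    opR T n (shift _ ξ) = shift _ (opR T n ξ) := by
  have h : ∀ (l : List ℕ) (ξ : HPow n), (l.map (braid T n)).prod (shift _ ξ) =
      shift _ ((l.map (braid T n)).prod ξ) := fun l => by
    induction l with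
    | nil => exact fun _ => rfl
    | cons k l ih =>
      intro ξ
      rw [List.map_cons, List.prod_cons]
      change braid T n k ((l.map (braid T n)).prod (shift _ ξ)) = _
      rw [ih, braid_shift hU]
      rfl
  rw [opR, sum_apply, sum_apply, map_sum]
  exact Finset.sum_congr rfl fun j _ => h _ ξ

theorem opP_shift (hU : CommutesWithShift T) :
    ∀ n (ξ : HPow n), opP T n (shift _ ξ) = shift _ (opP T n ξ)
  | 0, _ => rfl
  | n + 1, ξ => by
    change amp (consE n) (opP T n) (opR T (n + 1) (shift _ ξ)) = _
    rw [opR_shift hU, amp_shift (consE n) (fun p => by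
      funext i
      refine Fin.cases rfl (fun i => rfl) i) _ (opP_shift hU n)]
    rfl

theorem inner_opP_shift (hU : CommutesWithShift T) (n : ℕ) (ξ : HPow n) :
    inner ℂ (shift _ ξ) (opP T n (shift _ ξ)) = inner ℂ ξ (opP T n ξ) := by
  rw [opP_shift hU]
  exact LinearIsometryEquiv.inner_map_map (shift (Fin n → ℤ)) _ _

/-- `U^{⊗ n}` as an isometry for the `T`-deformed seminorm. -/
noncomputable def preShift (hT : IsYangBaxterHecke T) (hU : CommutesWithShift T) (n : ℕ) : PreFock hT n ≃ₗᵢ[ℂ] PreFock hT n where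
  toFun ξ := shift (Fin n → ℤ) ξ
  invFun ξ := (shift (Fin n → ℤ)).symm ξ
  map_add' := map_add (shift (Fin n → ℤ))
  map_smul' := map_smul (shift (Fin n → ℤ))
  left_inv := (shift (Fin n → ℤ)).symm_apply_apply
  right_inv := (shift (Fin n → ℤ)).apply_symm_apply
  norm_map' ξ := by
    refine (sq_eq_sq₀ (norm_nonneg _) (norm_nonneg _)).1 ?_
    rw [preFock_norm_sq, preFock_norm_sq]
    exact congrArg Complex.re (inner_opP_shift hU n ξ)

/-- The unitary extension to the completions. -/
noncomputable def completionEquiv {E : Type} [SeminormedAddCommGroup E] [InnerProductSpace ℂ E]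
    (e : E ≃ₗᵢ[ℂ] E) : UniformSpace.Completion E ≃ₗᵢ[ℂ] UniformSpace.Completion E where
  toFun := (e : E →L[ℂ] E).completion
  invFun := (e.symm : E →L[ℂ] E).completion
  map_add' := map_add _
  map_smul' := map_smul _
  left_inv x := by
    induction x using UniformSpace.Completion.induction_on with
    | hp => exact isClosed_eq (by fun_prop) (by fun_prop)
    | ih x => simp
  right_inv x := by
    induction x using UniformSpace.Completion.induction_on with
    | hp => exact isClosed_eq (by fun_prop) (by fun_prop)
    | ih x => simp
  norm_map' x := by
    induction x using UniformSpace.Completion.induction_on with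
    | hp =>
      exact isClosed_eq (f := fun x => ‖(e : E →L[ℂ] E).completion x‖) (by fun_prop) (by fun_prop)
    | ih x => simp

/-- The direct sum of a sequence of unitaries. -/
noncomputable def directSumEquiv {G : ℕ → Type} [∀ n, NormedAddCommGroup (G n)]
    [∀ n, InnerProductSpace ℂ (G n)] (V : ∀ n, G n ≃ₗᵢ[ℂ] G n) : lp G 2 ≃ₗᵢ[ℂ] lp G 2 where
  toFun ξ := ⟨fun n => V n (ξ n), (memlp_two_iff _).2 <| by
    simpa only [LinearIsometryEquiv.norm_map] using (hasSum_norm_sq ξ).summable⟩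
  invFun ξ := ⟨fun n => (V n).symm (ξ n), (memlp_two_iff _).2 <| by
    simpa only [LinearIsometryEquiv.norm_map] using (hasSum_norm_sq ξ).summable⟩
  map_add' ξ η := by ext n; exact map_add (V n) _ _
  map_smul' r ξ := by ext n; exact map_smul (V n) _ _
  left_inv ξ := by ext n; exact (V n).symm_apply_apply _
  right_inv ξ := by ext n; exact (V n).apply_symm_apply _
  norm_map' ξ := by
    refine (sq_eq_sq₀ (norm_nonneg _) (norm_nonneg _)).1 ?_
    refine (hasSum_norm_sq _).unique ?_
    convert hasSum_norm_sq ξ using 3 with n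
    exact (V n).norm_map _

/-- The second quantisation `𝓕_T(U)` of the shift: the unitary of the Fock space that is induced by
`U^{⊗ n}` on each `H_T^n`. -/
noncomputable def fockShift (hT : IsYangBaxterHecke T) (hU : CommutesWithShift T) : unitary (FockSpace hT →L[ℂ] FockSpace hT) :=
  Unitary.linearIsometryEquiv.symm (directSumEquiv fun n => completionEquiv (preShift hT hU n))

/-- The automorphism `A ↦ 𝓕_T(U) A 𝓕_T(U)*` of the bounded operators on the Fock space. -/
noncomputable def shiftAut (hT : IsYangBaxterHecke T) (hU : CommutesWithShift T) :
    (FockSpace hT →L[ℂ] FockSpace hT) ≃⋆ₐ[ℂ] (FockSpace hT →L[ℂ] FockSpace hT) :=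
  Unitary.conjStarAlgAut ℂ _ (fockShift hT hU)

end Shift

section CommutationRule

/-- `T (e_i ⊗ e_j) = ∑_{k,l} t_{ij}^{kl} e_k ⊗ e_l` -/
noncomputable def coeff (T : Ell2 (ℤ × ℤ) →L[ℂ] Ell2 (ℤ × ℤ)) (i j k l : ℤ) : ℂ :=
  T (lp.single 2 (i, j) 1) (k, l)

/-- The sum in each commutation rule `a_i a_j† - ∑_{k,l} t_{jl}^{ik} a_k† a_l = δ_{ij} I` is
finite. -/
def FiniteCommutationRule (T : Ell2 (ℤ × ℤ) →L[ℂ] Ell2 (ℤ × ℤ)) : Prop :=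
  ∀ i j : ℤ, {p : ℤ × ℤ | coeff T j p.2 i p.1 ≠ 0}.Finite

/-- The flip `e_i ⊗ e_j ↦ e_j ⊗ e_i`, which gives the Bose commutation relations. -/
noncomputable def flip : Ell2 (ℤ × ℤ) →L[ℂ] Ell2 (ℤ × ℤ) :=
  (reindex (Equiv.prodComm ℤ ℤ)).toContinuousLinearEquiv.toContinuousLinearMap

end CommutationRule

section Mixing

variable {A : Type} [CStarAlgebra A]

/-- `E` is an `α`-invariant conditional expectation of `A` onto the fixed-point subalgebra
`{a | α a = a}`. -/
structure IsInvariantCondExp (α : A ≃⋆ₐ[ℂ] A) (E : A →L[ℂ] A) : Prop where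
  fixed : ∀ a, α (E a) = E a
  apply_of_fixed : ∀ a, α a = a → E a = a
  norm_le : ∀ a, ‖E a‖ ≤ ‖a‖
  positive : ∀ a, ∃ b, E (star a * a) = star b * b
  bimodule : ∀ a b c, α b = b → α c = c → E (b * a * c) = b * E a * c
  invariant : ∀ a, E (α a) = E a

/-- The `C*`-dynamical system `(A, α)` is uniquely mixing with respect to the fixed-point
subalgebra: there is exactly one invariant conditional expectation `E` onto the fixed-point
subalgebra, and `f (αⁿ a) → f (E a)` for all `a ∈ A` and `f ∈ A*`. -/
def UniquelyMixing (α : A ≃⋆ₐ[ℂ] A) : Prop :=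
  ∃ E : A →L[ℂ] A, IsInvariantCondExp α E ∧ (∀ E', IsInvariantCondExp α E' → E' = E) ∧
    ∀ (a : A) (f : A →L[ℂ] ℂ),
      Filter.Tendsto (fun n : ℕ => f (α^[n] a)) Filter.atTop (nhds (f (E a)))

end Mixing

end TFock

/-! The automorphism pushes creation operators off to infinity, and sums of many creation operators
with distinct indices grow only like the square root of their number. Write a†_i E^m for the
component `cr hT i m` of the creation operator on H_T^m.

Normal ordering reduces the problem to simple elements. Since P^{(n+1)} = (I ⊗ P^{(n)}) R^{(n+1)},
the operator a(e_i) takes the e_i-slice of R^{(n+1)}, and R^{(n+2)} = I + T₁(I ⊗ R^{(n+1)}) then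
gives the commutation rule on each H_T^n (`annihilate_create_zero`, `annihilate_create_succ`). As
its sum is finite, every cut word is a finite linear combination of products with creators on the
left, annihilators on the right and some E^n between them. So 𝔈_T lies in the closed span of I and
these products (`algE_le_closure`).

The estimate comes from P^{(n+1)} ≤ C(I ⊗ P^{(n)}): the vectors e_k ⊗ ξ_k are orthogonal for the
form on the right, whence ‖∑_{k∈J} a†_k E^m Z_k‖ ≤ K c √|J| whenever all ‖Z_k‖ ≤ c
(`norm_sum_cr_mul_le`). The constant depends on m, which does no harm: m is fixed in each generator,
so no bound on sup ‖R^{(n)}‖ is needed and the Bose case is included.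

The automorphism maps a†_i E^m to a†_{i+1} E^m, so finite partial sums of the orbit of (a†_i E^m)X
over any index set J have norm O(√|J|). A sequence with this property is weakly null
(`tendsto_zero_of_norm_sum_le`). Adjoints cover products with an annihilator on the right, while I
and E^n are fixed. Weak convergence of orbits passes to closed spans (`IsWeakLimit.isClosed_setOf`),
and once every orbit converges weakly, the limit map is the unique invariant conditional expectation
(`uniquelyMixing_of_forall_isWeakLimit`). -/

namespace TFock

/-! ### Slices, product vectors and matrix coefficients. -/

section Slices

variable {α β γ : Type}

theorem slice_apply (e : β × α ≃ γ) (b : β) (ξ : Ell2 γ) (a : α) : slice e b ξ a = ξ (e (b, a)) :=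
  rfl

theorem tens_apply (e : β × α ≃ γ) (u : Ell2 β) (v : Ell2 α) (b : β) (a : α) :
    tens e u v (e (b, a)) = u b * v a := by
  change u (e.symm (e (b, a))).1 * v (e.symm (e (b, a))).2 = _
  rw [e.symm_apply_apply]

/-- Slicing at `b` is the adjoint of tensoring with the basis vector at `b`, so slices act as free
annihilation operators. -/
theorem inner_tens_left (e : β × α ≃ γ) [DecidableEq β] (b : β) (v : Ell2 α) (η : Ell2 γ) :
    inner ℂ (tens e (lp.single 2 b 1) v) η = inner ℂ v (slice e b η) := by
  refine (hasSum_inner_slice e _ _).unique ?_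
  convert hasSum_ite_eq b (inner ℂ v (slice e b η)) using 2 with b'
  rw [slice_tens, lp.coeFn_single, Pi.single_apply]
  split_ifs with h
  · rw [h, one_smul]
  · rw [zero_smul, inner_zero_left]

/-- Matrix expansion of the value of an operator at a coordinate. -/
theorem hasSum_apply_single [DecidableEq α] (A : Ell2 α →L[ℂ] Ell2 α) (v : Ell2 α) (c : α) :
    HasSum (fun a => v a * A (lp.single 2 a 1) c) (A v c) := by
  have h := ((lp.hasSum_single (p := 2) (by norm_num) v).mapL A).mapL (lp.evalCLM ℂ (fun _ => ℂ) 2 c)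
  have h1 : (fun a => v a * A (lp.single 2 a 1) c) =
      fun a => lp.evalCLM ℂ (fun _ => ℂ) 2 c (A (lp.single 2 a (v a))) := funext fun a => by
    have h2 : lp.single 2 a (v a) = v a • (lp.single 2 a (1 : ℂ) : Ell2 α) := by
      rw [← lp.single_smul, smul_eq_mul, mul_one]
    rw [h2, map_smul, map_smul]
    rfl
  rw [h1]
  exact h

end Slices

/-! ### Commutation rules and creation estimates on the n-particle spaces. -/

variable {T : Ell2 (ℤ × ℤ) →L[ℂ] Ell2 (ℤ × ℤ)} (hT : IsYangBaxterHecke T)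

/-- The class in `H_T^n` of a vector of `H^{⊗ n}`. -/
noncomputable def toN {n : ℕ} (ξ : HPow n) : NSpace hT n := UniformSpace.Completion.coe' (α := PreFock hT n) ξ

theorem toN_add {n : ℕ} (ξ η : HPow n) : toN hT (ξ + η) = toN hT ξ + toN hT η :=
  UniformSpace.Completion.coe_add (α := PreFock hT n) ξ η

theorem toN_smul {n : ℕ} (r : ℂ) (ξ : HPow n) : toN hT (r • ξ) = r • toN hT ξ :=
  UniformSpace.Completion.coe_smul (X := PreFock hT n) r ξ

theorem toN_zero {n : ℕ} : toN hT (0 : HPow n) = 0 :=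
  UniformSpace.Completion.coe_zero (α := PreFock hT n)

theorem toN_sum {n : ℕ} {ι : Type} (s : Finset ι) (ξ : ι → HPow n) :
    toN hT (∑ i ∈ s, ξ i) = ∑ i ∈ s, toN hT (ξ i) := by
  classical
  induction s using Finset.induction_on with
  | empty => exact toN_zero hT
  | insert i s hi ih => rw [Finset.sum_insert hi, Finset.sum_insert hi, toN_add, ih]

theorem denseRange_toN (n : ℕ) : DenseRange (toN hT (n := n)) :=
  UniformSpace.Completion.denseRange_coe (α := PreFock hT n)

theorem inner_toN {n : ℕ} (ξ η : HPow n) :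
    inner ℂ (toN hT ξ) (toN hT η) = inner ℂ ξ (opP T n η) :=
  UniformSpace.Completion.inner_coe (E := PreFock hT n) ξ η

theorem norm_toN_sq {n : ℕ} (ξ : HPow n) : ‖toN hT ξ‖ ^ 2 = (inner ℂ ξ (opP T n ξ)).re :=
  (congrArg (· ^ 2) (UniformSpace.Completion.norm_coe (E := PreFock hT n) ξ)).trans
    (preFock_norm_sq hT n ξ)

theorem create_toN (f : Ell2 ℤ) {n : ℕ} (ξ : HPow n) :
    create hT f n (toN hT ξ) = toN hT (tens (consE n) f ξ) :=
  ContinuousLinearMap.completion_apply_coe (preCreate hT f n) (ξ : PreFock hT n)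

theorem clm_ext_toN {n : ℕ} {F : Type*} [NormedAddCommGroup F] [NormedSpace ℂ F]
    {X Y : NSpace hT n →L[ℂ] F} (h : ∀ ξ : HPow n, X (toN hT ξ) = Y (toN hT ξ)) : X = Y :=
  DFunLike.coe_injective <|
    (denseRange_toN hT n).equalizer X.continuous Y.continuous (funext h)

/-- The annihilation operator `a(e_i)` is induced by `ℓ(e_i)* R^{(n+1)}`. -/
theorem annihilate_toN (i : ℤ) {n : ℕ} (η : HPow (n + 1)) :
    annihilate hT (lp.single 2 i 1) n (toN hT η) =
      toN hT (slice (consE n) i (opR T (n + 1) η)) := by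
  refine ext_inner_left ℂ fun x => ?_
  induction x using (denseRange_toN hT n).induction_on with
  | hp => exact isClosed_eq (by fun_prop) (by fun_prop)
  | ih ξ => ?_
  rw [annihilate, ContinuousLinearMap.adjoint_inner_right, create_toN, inner_toN, inner_toN]
  -- The recursion for `opP` holds by definition. Pairing with e_i ⊗ ξ selects the slice at `i`, and
  -- I ⊗ P^{(n)} becomes P^{(n)} on that slice.
  change inner ℂ _ (amp (consE n) (opP T n) (opR T (n + 1) η)) = _
  rw [inner_tens_left, slice_amp]

theorem annihilate_create_zero (i j : ℤ) :
    annihilate hT (lp.single 2 i 1) 0 ∘L create hT (lp.single 2 j 1) 0 =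
      (if i = j then (1 : ℂ) else 0) • ContinuousLinearMap.id ℂ _ := by
  refine clm_ext_toN hT fun ξ => ?_
  change annihilate hT _ 0 (create hT _ 0 (toN hT ξ)) = (if i = j then (1 : ℂ) else 0) • toN hT ξ
  rw [create_toN, annihilate_toN, opR_one]
  change toN hT (slice (consE 0) i (tens (consE 0) _ ξ)) = _
  rw [slice_tens, toN_smul, lp.coeFn_single, Pi.single_apply]

/-- The coefficient of e_i ⊗ e_k in T(e_j ⊗ e_l) is t_{jl}^{ik}; the index `p` stands for (k, l).
Any finite `F` containing the support will do, and this is where finiteness of the commutation rule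
makes the sum algebraic. -/
theorem slice_head_tens (m : ℕ) (i j : ℤ) (F : Finset (ℤ × ℤ))
    (hF : ∀ p, coeff T j p.2 i p.1 ≠ 0 → p ∈ F) (ζ : HPow (m + 1)) :
    slice (consE (m + 1)) i (amp (headE m) T (tens (consE (m + 1)) (lp.single 2 j 1) ζ)) =
      ∑ p ∈ F, coeff T j p.2 i p.1 •
        tens (consE m) (lp.single 2 p.1 1) (slice (consE m) p.2 ζ) := by
  classical
  refine ext_slice (consE m) fun k => ?_
  rw [map_sum]
  simp only [map_smul, slice_tens]
  ext z
  rw [lp.coeFn_sum, Finset.sum_apply]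
  change slice (headE m) z (amp (headE m) T _) (i, k) = _
  rw [slice_amp]
  refine (hasSum_apply_single T _ (i, k)).unique ?_
  -- In the matrix expansion of T only the entries (j, l) meet e_j ⊗ ζ, and those with l not
  -- occurring in `F` have coefficient zero, so the series is a finite sum.
  have h : ∀ p ∉ F.image (fun p => (j, p.2)),
      slice (headE m) z (tens (consE (m + 1)) (lp.single 2 j (1 : ℂ)) ζ) p *
        T (lp.single 2 p 1) (i, k) = 0 := by
    rintro ⟨a, b⟩ hp
    change (lp.single 2 j (1 : ℂ) : Ell2 ℤ) a * ζ (Fin.cons b z) * _ = 0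
    rw [lp.coeFn_single, Pi.single_apply]
    split_ifs with ha
    · subst ha
      by_cases hc : coeff T a b i k = 0
      · rw [coeff] at hc
        rw [hc, mul_zero]
      · exact absurd (Finset.mem_image.2 ⟨(k, b), hF (k, b) hc, rfl⟩) hp
    · rw [zero_mul, zero_mul]
  convert hasSum_sum_of_ne_finset_zero (L := .unconditional _) h using 1
  have h2 : ∀ p ∈ F, (coeff T j p.2 i p.1 • (lp.single 2 p.1 (1 : ℂ) : Ell2 ℤ) k •
      slice (consE m) p.2 ζ : HPow m) z = if p.1 = k then coeff T j p.2 i k * ζ (Fin.cons p.2 z)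
        else 0 := fun p hp => by
    change coeff T j p.2 i p.1 * ((lp.single 2 p.1 (1 : ℂ) : Ell2 ℤ) k * ζ (Fin.cons p.2 z)) = _
    rw [lp.coeFn_single, Pi.single_apply]
    split_ifs with h1 h2 h2
    · rw [h1, one_mul]
    · exact absurd h1.symm h2
    · exact absurd h2.symm h1
    · rw [zero_mul, mul_zero]
  rw [Finset.sum_congr rfl h2, ← Finset.sum_filter]
  have h3 : ∀ b, slice (headE m) z (tens (consE (m + 1)) (lp.single 2 j (1 : ℂ)) ζ) (j, b) *
      T (lp.single 2 (j, b) 1) (i, k) = coeff T j b i k * ζ (Fin.cons b z) := fun b => by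
    change (lp.single 2 j (1 : ℂ) : Ell2 ℤ) j * ζ (Fin.cons b z) * coeff T j b i k = _
    rw [lp.coeFn_single, Pi.single_apply, if_pos rfl, one_mul, mul_comm]
  -- With the first index pinned to `k`, the map (k, l) ↦ (j, l) is injective. Entries (j, l) coming
  -- from pairs with another first index are discarded below, since their coefficient vanishes
  -- unless (k, l) ∈ `F`.
  have h4 : ∑ p ∈ F.filter (fun p => p.1 = k), coeff T j p.2 i k * ζ (Fin.cons p.2 z) =
      ∑ p ∈ (F.filter (fun p => p.1 = k)).image (fun p => (j, p.2)),
        coeff T j p.2 i k * ζ (Fin.cons p.2 z) := by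
    rw [Finset.sum_image]
    rintro ⟨a, b⟩ ha ⟨a', b'⟩ ha' hab
    have h1 := (Finset.mem_filter.1 ha).2
    have h2 := (Finset.mem_filter.1 ha').2
    simp_all
  rw [h4]
  refine (Finset.sum_congr rfl fun p hp => ?_).trans (Finset.sum_subset
    (Finset.image_subset_image (Finset.filter_subset _ F)) fun p hp hp' => ?_)
  · obtain ⟨p', -, rfl⟩ := Finset.mem_image.1 hp
    exact (h3 _).symm
  · obtain ⟨p', hp1, rfl⟩ := Finset.mem_image.1 hp
    rw [h3]
    by_contra hne
    exact hp' (Finset.mem_image.2 ⟨(k, p'.2),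
      Finset.mem_filter.2 ⟨hF (k, p'.2) (left_ne_zero_of_mul hne), rfl⟩, rfl⟩)

/-- The commutation rule `a_i a_j† = δ_{ij} + ∑_{k,l} t_{jl}^{ik} a_k† a_l` on `H_T^{m+1}`. -/
theorem annihilate_create_succ (m : ℕ) (i j : ℤ) (F : Finset (ℤ × ℤ))
    (hF : ∀ p, coeff T j p.2 i p.1 ≠ 0 → p ∈ F) :
    annihilate hT (lp.single 2 i 1) (m + 1) ∘L create hT (lp.single 2 j 1) (m + 1) =
      (if i = j then (1 : ℂ) else 0) • ContinuousLinearMap.id ℂ _ +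
        ∑ p ∈ F, coeff T j p.2 i p.1 •
          (create hT (lp.single 2 p.1 1) m ∘L annihilate hT (lp.single 2 p.2 1) m) := by
  refine clm_ext_toN hT fun ξ => ?_
  rw [add_apply, sum_apply]
  change annihilate hT _ (m + 1) (create hT _ (m + 1) (toN hT ξ)) =
    (if i = j then (1 : ℂ) else 0) • toN hT ξ + ∑ p ∈ F, coeff T j p.2 i p.1 • create hT (lp.single 2 p.1 1) m
      (annihilate hT (lp.single 2 p.2 1) m (toN hT ξ))
  simp only [annihilate_toN, create_toN, ← toN_smul, ← toN_sum, ← toN_add]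
  -- In I + T₁(I ⊗ R^{(m+1)}) the summand I yields δ_{ij}. In the other one R^{(m+1)} acts on `ξ`,
  -- the operator T₁ produces the coefficients, and the slice of R^{(m+1)}ξ at l is a(e_l)ξ.
  rw [opR_succ]
  change toN hT (slice (consE (m + 1)) i (tens (consE (m + 1)) _ ξ + amp (headE m) T (amp (consE (m + 1))
    (opR T (m + 1)) _))) = _
  rw [amp_tens, map_add, slice_head_tens m i j F hF, slice_tens,
    lp.coeFn_single, Pi.single_apply]

/-- After P^{(n+1)} is replaced by the larger K(I ⊗ P^{(n)}), the vectors e_k ⊗ ξ_k with different k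
are orthogonal and the cross terms disappear. The constant is uniform in `J`. -/
theorem norm_sum_create_sq_le (n : ℕ) : ∃ K : ℝ, 0 ≤ K ∧ ∀ (J : Finset ℤ) (x : ℤ → NSpace hT n),
    ‖∑ k ∈ J, create hT (lp.single 2 k 1) n (x k)‖ ^ 2 ≤ K * ∑ k ∈ J, ‖x k‖ ^ 2 := by
  obtain ⟨K, hK, h⟩ := opP_succ_le hT n
  refine ⟨K, hK, fun J x => ?_⟩
  -- Families of classes of genuine tensors are dense in the product topology, and both sides
  -- involve only the finitely many coordinates in `J`.
  have hd : DenseRange (Pi.map fun (_ : ℤ) => toN hT (n := n)) :=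
    DenseRange.piMap fun _ => denseRange_toN hT n
  induction x using hd.induction_on with
  | hp =>
    exact isClosed_le (by fun_prop) (by fun_prop)
  | ih ξ =>
    simp only [Pi.map_apply, create_toN, ← toN_sum, norm_toN_sq]
    refine (h _).trans (mul_le_mul_of_nonneg_left (le_of_eq ?_) hK)
    rw [← Complex.re_sum]
    refine congrArg Complex.re ?_
    rw [sum_inner]
    refine Finset.sum_congr rfl fun k hk => ?_
    rw [inner_tens_left, slice_amp, map_sum]
    congr 2
    simp only [slice_tens, lp.coeFn_single, Pi.single_apply, ite_smul, one_smul, zero_smul]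
    rw [Finset.sum_ite_eq, if_pos hk]

end TFock

namespace TFock

variable {T : Ell2 (ℤ × ℤ) →L[ℂ] Ell2 (ℤ × ℤ)} (hT : IsYangBaxterHecke T)

/-! ### Components of the creation and annihilation operators on the Fock space. -/

section Blocks

/-- The operator on the Fock space that maps `H_T^n` to `H_T^m` by `X` and kills the other
summands. -/
noncomputable def block (m n : ℕ) :
    (NSpace hT n →L[ℂ] NSpace hT m) →ₗ[ℂ] (FockSpace hT →L[ℂ] FockSpace hT) where
  toFun X := lp.singleContinuousLinearMap ℂ (fun n => NSpace hT n) 2 m ∘L X ∘L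
    lp.evalCLM ℂ (fun n => NSpace hT n) 2 n
  map_add' X Y := by
    ext1 ξ
    exact map_add (lp.singleContinuousLinearMap ℂ (fun n => NSpace hT n) 2 m) _ _
  map_smul' r X := by
    ext1 ξ
    exact map_smul (lp.singleContinuousLinearMap ℂ (fun n => NSpace hT n) 2 m) _ _

theorem block_apply (m n : ℕ) (X : NSpace hT n →L[ℂ] NSpace hT m) (ξ : FockSpace hT) :
    block hT m n X ξ = lp.single 2 m (X (ξ n)) := rfl

theorem block_mul (m k n : ℕ) (X : NSpace hT k →L[ℂ] NSpace hT m)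
    (Y : NSpace hT n →L[ℂ] NSpace hT k) :
    block hT m k X * block hT k n Y = block hT m n (X ∘L Y) := by
  ext1 ξ
  change block hT m k X (block hT k n Y ξ) = _
  rw [block_apply, block_apply, lp.single_apply_self]
  rfl

theorem block_mul_of_ne {m k k' n : ℕ} (h : k ≠ k') (X : NSpace hT k →L[ℂ] NSpace hT m)
    (Y : NSpace hT n →L[ℂ] NSpace hT k') : block hT m k X * block hT k' n Y = 0 := by
  ext1 ξ
  change block hT m k X (block hT k' n Y ξ) = 0
  rw [block_apply, block_apply, lp.single_apply_ne _ _ _ h, map_zero]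
  exact map_zero (lp.singleContinuousLinearMap ℂ (fun n => NSpace hT n) 2 m)

theorem star_block (m n : ℕ) (X : NSpace hT n →L[ℂ] NSpace hT m) :
    star (block hT m n X) = block hT n m X.adjoint := by
  rw [ContinuousLinearMap.star_eq_adjoint]
  refine ((ContinuousLinearMap.eq_adjoint_iff _ _).2 fun ξ η => ?_).symm
  rw [block_apply, block_apply, lp.inner_single_left, lp.inner_single_right,
    ContinuousLinearMap.adjoint_inner_left]

/-- The projection `E^n` onto `H_T^n`. -/
noncomputable def proj (n : ℕ) : FockSpace hT →L[ℂ] FockSpace hT :=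
  block hT n n (ContinuousLinearMap.id ℂ _)

/-- The operator `a†(e_i) E^m`. -/
noncomputable def cr (i : ℤ) (m : ℕ) : FockSpace hT →L[ℂ] FockSpace hT :=
  block hT (m + 1) m (create hT (lp.single 2 i 1) m)

theorem star_cr (i : ℤ) (m : ℕ) :
    star (cr hT i m) = block hT m (m + 1) (annihilate hT (lp.single 2 i 1) m) :=
  star_block hT _ _ _

theorem star_proj (n : ℕ) : star (proj hT n) = proj hT n := by
  rw [proj, star_block, ContinuousLinearMap.adjoint_id]

theorem proj_mul_block (m n : ℕ) (X : NSpace hT n →L[ℂ] NSpace hT m) :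
    proj hT m * block hT m n X = block hT m n X := block_mul hT _ _ _ _ _

theorem proj_mul_block_of_ne {k m n : ℕ} (h : k ≠ m) (X : NSpace hT n →L[ℂ] NSpace hT m) :
    proj hT k * block hT m n X = 0 := block_mul_of_ne hT h _ _

theorem star_cr_mul_cr_of_ne (i j : ℤ) {m m' : ℕ} (h : m ≠ m') :
    star (cr hT i m) * cr hT j m' = 0 := by
  rw [star_cr]
  exact block_mul_of_ne hT (by omega) _ _

theorem star_cr_mul_cr_zero (i j : ℤ) :
    star (cr hT i 0) * cr hT j 0 = (if i = j then (1 : ℂ) else 0) • proj hT 0 := by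
  rw [star_cr, cr, block_mul, annihilate_create_zero, map_smul]
  rfl

/-- The commutation rule for the components of the creation operators. -/
theorem star_cr_mul_cr_succ (i j : ℤ) (m : ℕ) (F : Finset (ℤ × ℤ))
    (hF : ∀ p, coeff T j p.2 i p.1 ≠ 0 → p ∈ F) :
    star (cr hT i (m + 1)) * cr hT j (m + 1) = (if i = j then (1 : ℂ) else 0) • proj hT (m + 1) +
      ∑ p ∈ F, coeff T j p.2 i p.1 • (cr hT p.1 m * star (cr hT p.2 m)) := by
  rw [star_cr, cr, block_mul, annihilate_create_succ hT m i j F hF, map_add, map_smul, map_sum]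
  refine congrArg₂ _ rfl (Finset.sum_congr rfl fun p _ => ?_)
  rw [map_smul, star_cr, cr, block_mul]

theorem cutWord_eq_block (m : ℕ) (w : List (Bool × ℤ)) (n : ℕ) : cutWord hT m w n = block hT m n
    ((wordBlock hT m w n).mkContinuousOfExistsBound (wordBlock_bound hT m w n)) := rfl

theorem cutWord_nil_self (n : ℕ) : cutWord hT n [] n = proj hT n := by
  rw [cutWord_eq_block, proj]
  congr 1
  ext1 x
  exact DirectSum.of_eq_same (β := fun n => NSpace hT n) _ _

theorem cutWord_nil_of_ne {m n : ℕ} (h : m ≠ n) : cutWord hT m [] n = 0 := by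
  rw [cutWord_eq_block, ← map_zero (block hT m n)]
  congr 1
  ext1 x
  exact DirectSum.of_eq_of_ne (β := fun n => NSpace hT n) _ _ _ h

theorem cutWord_create_zero (i : ℤ) (w : List (Bool × ℤ)) (n : ℕ) :
    cutWord hT 0 ((true, i) :: w) n = 0 := by
  rw [cutWord_eq_block, ← map_zero (block hT 0 n)]
  congr 1
  ext1 x
  exact component_createFin_zero hT _ _

/-- Each letter changes the particle number by exactly one, so the target number determines which
component the leftmost letter contributes. This recursion factors cut words into the operators `cr`
and their adjoints. -/
theorem cutWord_create_succ (m : ℕ) (i : ℤ) (w : List (Bool × ℤ)) (n : ℕ) :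
    cutWord hT (m + 1) ((true, i) :: w) n = cr hT i m * cutWord hT m w n := by
  rw [cutWord_eq_block, cutWord_eq_block, cr, block_mul]
  congr 1
  ext1 x
  exact component_createFin_succ hT _ _ _

theorem cutWord_annihilate (m : ℕ) (i : ℤ) (w : List (Bool × ℤ)) (n : ℕ) :
    cutWord hT m ((false, i) :: w) n = star (cr hT i m) * cutWord hT (m + 1) w n := by
  rw [cutWord_eq_block, cutWord_eq_block, star_cr, block_mul]
  congr 1
  ext1 x
  exact component_annihilateFin hT _ _ _

/-- This is the square root of `norm_sum_create_sq_le`, applied to the m-particle components of Z_k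
ξ. The `Z k` are arbitrary bounded operators, which later allows the whole right factor to vary
along the orbit. -/
theorem norm_sum_cr_mul_le (m : ℕ) : ∃ K : ℝ, 0 ≤ K ∧ ∀ (J : Finset ℤ)
    (Z : ℤ → FockSpace hT →L[ℂ] FockSpace hT) (c : ℝ), (∀ k ∈ J, ‖Z k‖ ≤ c) →
      ‖∑ k ∈ J, cr hT k m * Z k‖ ≤ K * c * √J.card := by
  obtain ⟨K, hK, h⟩ := norm_sum_create_sq_le hT m
  refine ⟨√K, K.sqrt_nonneg, fun J Z c hZ => ?_⟩
  rcases J.eq_empty_or_nonempty with rfl | ⟨k₀, hk₀⟩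
  · simp
  have hc : 0 ≤ c := (norm_nonneg _).trans (hZ k₀ hk₀)
  refine ContinuousLinearMap.opNorm_le_bound _ (by positivity) fun ξ => ?_
  refine (sq_le_sq₀ (norm_nonneg _) (by positivity)).1 ?_
  have h1 : (∑ k ∈ J, cr hT k m * Z k) ξ =
      lp.single 2 (m + 1) (∑ k ∈ J, create hT (lp.single 2 k 1) m (Z k ξ m)) := by
    rw [sum_apply]
    exact (map_sum (lp.singleContinuousLinearMap ℂ (fun n => NSpace hT n) 2 (m + 1)) _ _).symm
  rw [h1, lp.norm_single (by norm_num)]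
  refine (h J fun k => Z k ξ m).trans ?_
  have h2 : ∀ k ∈ J, ‖Z k ξ m‖ ^ 2 ≤ (c * ‖ξ‖) ^ 2 := fun k hk => by
    gcongr
    exact (lp.norm_apply_le_norm (by norm_num) _ _).trans
      ((Z k).le_of_opNorm_le (hZ k hk) ξ)
  have h3 := Finset.sum_le_card_nsmul J _ _ h2
  rw [nsmul_eq_mul] at h3
  calc K * ∑ k ∈ J, ‖Z k ξ m‖ ^ 2 ≤ K * (J.card * (c * ‖ξ‖) ^ 2) := by gcongr
    _ = √K ^ 2 * √J.card ^ 2 * (c * ‖ξ‖) ^ 2 := by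
      rw [Real.sq_sqrt hK, Real.sq_sqrt (Nat.cast_nonneg _)]
      ring
    _ = (√K * c * √J.card * ‖ξ‖) ^ 2 := by ring

end Blocks

/-! ### Normal ordering in 𝔈_T. -/

section NormalOrder

/-- The normal ordered products of the components of creation and annihilation operators. -/
inductive IsNormalOrdered : (FockSpace hT →L[ℂ] FockSpace hT) → Prop
  | proj (n : ℕ) : IsNormalOrdered (proj hT n)
  | cr_mul (i : ℤ) (m : ℕ) (X : FockSpace hT →L[ℂ] FockSpace hT) :
      IsNormalOrdered X → IsNormalOrdered (cr hT i m * X)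
  | mul_star_cr (i : ℤ) (m : ℕ) (X : FockSpace hT →L[ℂ] FockSpace hT) :
      IsNormalOrdered X → IsNormalOrdered (X * star (cr hT i m))

/-- The span of the normal ordered products. -/
noncomputable def normalSpan : Submodule ℂ (FockSpace hT →L[ℂ] FockSpace hT) :=
  Submodule.span ℂ {X | IsNormalOrdered hT X}

variable {hT}

theorem IsNormalOrdered.mem {X : FockSpace hT →L[ℂ] FockSpace hT} (h : IsNormalOrdered hT X) :
    X ∈ normalSpan hT := Submodule.subset_span h

theorem IsNormalOrdered.star {X : FockSpace hT →L[ℂ] FockSpace hT} (h : IsNormalOrdered hT X) :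
    IsNormalOrdered hT (star X) := by
  induction h with
  | proj n => rw [star_proj]; exact .proj n
  | cr_mul i m X _ ih => rw [star_mul]; exact .mul_star_cr i m _ ih
  | mul_star_cr i m X _ ih => rw [star_mul, star_star]; exact .cr_mul i m _ ih

theorem mul_mem_of_left {Z : FockSpace hT →L[ℂ] FockSpace hT}
    (h : ∀ X, IsNormalOrdered hT X → Z * X ∈ normalSpan hT)
    {X : FockSpace hT →L[ℂ] FockSpace hT} (hX : X ∈ normalSpan hT) : Z * X ∈ normalSpan hT :=
  (Submodule.span_le (p := (normalSpan hT).comap (LinearMap.mulLeft ℂ Z))).2 h hX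

theorem mul_mem_of_right {Z : FockSpace hT →L[ℂ] FockSpace hT}
    (h : ∀ X, IsNormalOrdered hT X → X * Z ∈ normalSpan hT)
    {X : FockSpace hT →L[ℂ] FockSpace hT} (hX : X ∈ normalSpan hT) : X * Z ∈ normalSpan hT :=
  (Submodule.span_le (p := (normalSpan hT).comap (LinearMap.mulRight ℂ Z))).2 h hX

theorem star_mem_normalSpan {X : FockSpace hT →L[ℂ] FockSpace hT} (hX : X ∈ normalSpan hT) :
    star X ∈ normalSpan hT := by
  induction hX using Submodule.span_induction with
  | mem X h => exact h.star.mem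
  | zero => rw [star_zero]; exact zero_mem _
  | add X Y _ _ h1 h2 => rw [star_add]; exact add_mem h1 h2
  | smul r X _ h => rw [star_smul]; exact Submodule.smul_mem _ _ h

theorem cr_mul_mem (i : ℤ) (m : ℕ) {X : FockSpace hT →L[ℂ] FockSpace hT}
    (hX : X ∈ normalSpan hT) : cr hT i m * X ∈ normalSpan hT :=
  mul_mem_of_left (fun _ h => (h.cr_mul i m).mem) hX

theorem mul_star_cr_mem (i : ℤ) (m : ℕ) {X : FockSpace hT →L[ℂ] FockSpace hT}
    (hX : X ∈ normalSpan hT) : X * star (cr hT i m) ∈ normalSpan hT :=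
  mul_mem_of_right (fun _ h => (h.mul_star_cr i m).mem) hX

theorem proj_mul_mem (n : ℕ) {X : FockSpace hT →L[ℂ] FockSpace hT}
    (hX : X ∈ normalSpan hT) : proj hT n * X ∈ normalSpan hT := by
  refine mul_mem_of_left (fun X h => ?_) hX
  induction h with
  | proj k =>
    rcases eq_or_ne n k with rfl | h
    · rw [proj.eq_1, block_mul]; exact (IsNormalOrdered.proj n).mem
    · rw [proj.eq_1 hT k, proj_mul_block_of_ne hT h]; exact zero_mem _
  | cr_mul i m X hX ih =>
    rw [← mul_assoc]
    rcases eq_or_ne n (m + 1) with rfl | h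
    · rw [cr, proj_mul_block]; exact (hX.cr_mul i m).mem
    · rw [cr, proj_mul_block_of_ne hT h, zero_mul]; exact zero_mem _
  | mul_star_cr i m X _ ih => rw [← mul_assoc]; exact mul_star_cr_mem i m ih

/-- An annihilator is moved to the right through the creators by the commutation rule. The rule
replaces it by annihilators with other indices on a space with one particle less, so the induction
must allow `i` and `m` to vary. -/
theorem star_cr_mul_mem (hf : FiniteCommutationRule T) (i : ℤ) (m : ℕ)
    {X : FockSpace hT →L[ℂ] FockSpace hT} (hX : X ∈ normalSpan hT) :
    star (cr hT i m) * X ∈ normalSpan hT := by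
  refine mul_mem_of_left (fun X h => ?_) hX
  clear hX
  induction h generalizing i m with
  | proj k =>
    rw [proj, star_cr]
    rcases eq_or_ne (m + 1) k with rfl | h
    -- The annihilator absorbs the projection on its right, and becomes normal ordered once E^m is
    -- inserted on its left.
    · rw [block_mul, ContinuousLinearMap.comp_id, ← proj_mul_block, ← star_cr]
      exact mul_star_cr_mem i m (IsNormalOrdered.proj m).mem
    · rw [block_mul_of_ne hT h]; exact zero_mem _
  | cr_mul j m' X hX ih =>
    rw [← mul_assoc]
    rcases eq_or_ne m m' with rfl | h
    · rcases m with _ | m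
      · rw [star_cr_mul_cr_zero, smul_mul_assoc]
        exact Submodule.smul_mem _ _ (proj_mul_mem 0 hX.mem)
      · rw [star_cr_mul_cr_succ hT i j m (hf i j).toFinset fun p hp => (hf i j).mem_toFinset.2 hp,
          add_mul, Finset.sum_mul, smul_mul_assoc]
        refine add_mem (Submodule.smul_mem _ _ (proj_mul_mem _ hX.mem)) (sum_mem fun p _ => ?_)
        rw [smul_mul_assoc, mul_assoc]
        exact Submodule.smul_mem _ _ (cr_mul_mem _ _ (ih _ _))
    · rw [star_cr_mul_cr_of_ne hT i j h, zero_mul]; exact zero_mem _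
  | mul_star_cr j m' X _ ih => rw [← mul_assoc]; exact mul_star_cr_mem j m' (ih i m)

theorem mul_mem_normalSpan (hf : FiniteCommutationRule T)
    {X Y : FockSpace hT →L[ℂ] FockSpace hT} (hX : X ∈ normalSpan hT) (hY : Y ∈ normalSpan hT) :
    X * Y ∈ normalSpan hT := by
  refine mul_mem_of_right (fun X h => ?_) hX
  clear hX
  induction h generalizing Y with
  | proj n => exact proj_mul_mem n hY
  | cr_mul i m X _ ih => rw [mul_assoc]; exact cr_mul_mem i m (ih hY)
  | mul_star_cr i m X _ ih => rw [mul_assoc]; exact ih (star_cr_mul_mem hf i m hY)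

theorem cutWord_mem_normalSpan (hf : FiniteCommutationRule T) (m : ℕ) (w : List (Bool × ℤ))
    (n : ℕ) : cutWord hT m w n ∈ normalSpan hT := by
  induction w generalizing m with
  | nil =>
    rcases eq_or_ne m n with rfl | h
    · rw [cutWord_nil_self]; exact (IsNormalOrdered.proj m).mem
    · rw [cutWord_nil_of_ne hT h]; exact zero_mem _
  | cons p w ih =>
    obtain ⟨_ | _, i⟩ := p
    · rw [cutWord_annihilate]; exact star_cr_mul_mem hf i m (ih (m + 1))
    · rcases m with _ | m
      · rw [cutWord_create_zero]; exact zero_mem _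
      · rw [cutWord_create_succ]; exact cr_mul_mem i m (ih m)

/-- By normal ordering, `𝔈_T` is the closed span of the identity and the normal ordered products. -/
theorem algE_le_closure (hf : FiniteCommutationRule T) {X : FockSpace hT →L[ℂ] FockSpace hT}
    (hX : X ∈ algE hT) : X ∈ (ℂ ∙ 1 ⊔ normalSpan hT).topologicalClosure := by
  -- Both sides are closures, so it suffices that ℂ·1 + `normalSpan hT` contains the cut words and
  -- is closed under sums, products and adjoints.
  refine closure_mono (fun X hX => ?_) hX
  refine StarAlgebra.adjoin_induction (p := fun X _ => X ∈ ℂ ∙ 1 ⊔ normalSpan hT)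
    ?_ ?_ ?_ ?_ ?_ hX
  · rintro _ ⟨m, w, n, rfl⟩
    exact Submodule.mem_sup_right (cutWord_mem_normalSpan hf m w n)
  · intro r
    rw [Algebra.algebraMap_eq_smul_one]
    exact Submodule.mem_sup_left (Submodule.smul_mem _ _ (Submodule.mem_span_singleton_self _))
  · exact fun X Y _ _ hX hY => add_mem hX hY
  · intro X Y _ _ hX hY
    obtain ⟨a, ha, X, hX', rfl⟩ := Submodule.mem_sup.1 hX
    obtain ⟨b, hb, Y, hY', rfl⟩ := Submodule.mem_sup.1 hY
    obtain ⟨r, rfl⟩ := Submodule.mem_span_singleton.1 ha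
    obtain ⟨s, rfl⟩ := Submodule.mem_span_singleton.1 hb
    rw [add_mul, mul_add, mul_add, smul_one_mul, smul_one_mul, mul_smul_one, add_assoc]
    refine add_mem (Submodule.mem_sup_left (Submodule.smul_mem _ _ hb)) ?_
    refine Submodule.mem_sup_right (add_mem (Submodule.smul_mem _ _ hY') (add_mem
      (Submodule.smul_mem _ _ hX') (mul_mem_normalSpan hf hX' hY')))
  · intro X _ hX
    obtain ⟨a, ha, X, hX', rfl⟩ := Submodule.mem_sup.1 hX
    obtain ⟨r, rfl⟩ := Submodule.mem_span_singleton.1 ha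
    rw [star_add, star_smul, star_one]
    exact add_mem (Submodule.mem_sup_left (Submodule.smul_mem _ _
      (Submodule.mem_span_singleton_self _))) (Submodule.mem_sup_right (star_mem_normalSpan hX'))

theorem proj_mem_algE (n : ℕ) : proj hT n ∈ algE hT :=
  StarSubalgebra.le_topologicalClosure _
    (StarAlgebra.subset_adjoin ℂ _ ⟨n, [], n, (cutWord_nil_self hT n).symm⟩)

end NormalOrder

/-! ### The shift automorphism on components, and its restriction to 𝔈_T. -/

section ShiftAction

variable (hU : CommutesWithShift T)

theorem completionEquiv_toN (n : ℕ) (ξ : HPow n) :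
    completionEquiv (preShift hT hU n) (toN hT ξ) = toN hT (shift _ ξ) :=
  ContinuousLinearMap.completion_apply_coe
    (preShift hT hU n : PreFock hT n →L[ℂ] PreFock hT n) (ξ : PreFock hT n)

theorem fockShift_apply (ξ : FockSpace hT) (n : ℕ) :
    (fockShift hT hU : FockSpace hT →L[ℂ] FockSpace hT) ξ n =
      completionEquiv (preShift hT hU n) (ξ n) := rfl

theorem shiftAut_eq_of_comm {X Y : FockSpace hT →L[ℂ] FockSpace hT}
    (h : (fockShift hT hU : FockSpace hT →L[ℂ] FockSpace hT) * X = Y * fockShift hT hU) :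
    shiftAut hT hU X = Y := by
  rw [shiftAut, Unitary.conjStarAlgAut_apply, h, mul_assoc,
    Unitary.mul_star_self_of_mem (fockShift hT hU).2, mul_one]

/-- The second quantisation preserves particle number, so conjugation of a block can be computed
from an intertwining relation between two n-particle spaces. -/
theorem shiftAut_block {m n : ℕ} {X Y : NSpace hT n →L[ℂ] NSpace hT m}
    (h : ∀ x, completionEquiv (preShift hT hU m) (X x) =
      Y (completionEquiv (preShift hT hU n) x)) :
    shiftAut hT hU (block hT m n X) = block hT m n Y := by
  refine shiftAut_eq_of_comm hT hU ?_
  ext1 ξ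
  change (fockShift hT hU : FockSpace hT →L[ℂ] FockSpace hT) (block hT m n X ξ) =
    block hT m n Y ((fockShift hT hU : FockSpace hT →L[ℂ] FockSpace hT) ξ)
  rw [block_apply, block_apply, fockShift_apply, ← h]
  ext k
  rw [fockShift_apply]
  rcases eq_or_ne k m with rfl | hk
  · rw [lp.single_apply_self, lp.single_apply_self]
  · rw [lp.single_apply_ne _ _ _ hk, lp.single_apply_ne _ _ _ hk, map_zero]

theorem shiftAut_proj (n : ℕ) : shiftAut hT hU (proj hT n) = proj hT n :=
  shiftAut_block hT hU fun _ => rfl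

theorem shift_tens (m : ℕ) (i : ℤ) (ξ : HPow m) :
    shift _ (tens (consE m) (lp.single 2 i 1) ξ) =
      tens (consE m) (lp.single 2 (i + 1) 1) (shift _ ξ) := by
  ext z
  obtain ⟨⟨k, z⟩, rfl⟩ := (consE m).surjective z
  rw [tens_apply]
  change (lp.single 2 i (1 : ℂ) : Ell2 ℤ) (k + -1) * ξ (z + -1) = _ * ξ (z + -1)
  congr 1
  rw [lp.coeFn_single, lp.coeFn_single, Pi.single_apply, Pi.single_apply]
  congr 1
  exact propext (by omega)

theorem shiftAut_cr (i : ℤ) (m : ℕ) : shiftAut hT hU (cr hT i m) = cr hT (i + 1) m := by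
  refine shiftAut_block hT hU fun x => ?_
  induction x using (denseRange_toN hT m).induction_on with
  | hp =>
    exact isClosed_eq ((LinearIsometryEquiv.continuous _).comp (by fun_prop))
      ((ContinuousLinearMap.continuous _).comp (LinearIsometryEquiv.continuous _))
  | ih ξ =>
    rw [create_toN, completionEquiv_toN, completionEquiv_toN, create_toN, shift_tens]

theorem shiftAut_iterate_cr (i : ℤ) (m k : ℕ) :
    (shiftAut hT hU)^[k] (cr hT i m) = cr hT (i + k) m := by
  induction k with
  | zero => simp
  | succ k ih =>
    rw [Function.iterate_succ_apply', ih, shiftAut_cr]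
    push_cast
    rw [add_assoc]

theorem shiftAut_star (X : FockSpace hT →L[ℂ] FockSpace hT) :
    shiftAut hT hU (star X) = star (shiftAut hT hU X) := (shiftAut hT hU).map_star' X

theorem shiftAut_cutWord (m : ℕ) (w : List (Bool × ℤ)) (n : ℕ) :
    shiftAut hT hU (cutWord hT m w n) = cutWord hT m (w.map fun p => (p.1, p.2 + 1)) n := by
  induction w generalizing m with
  | nil =>
    rw [List.map_nil]
    rcases eq_or_ne m n with rfl | h
    · rw [cutWord_nil_self, shiftAut_proj]
    · rw [cutWord_nil_of_ne hT h, map_zero]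
  | cons p w ih =>
    obtain ⟨_ | _, i⟩ := p
    · rw [List.map_cons, cutWord_annihilate, map_mul, shiftAut_star, shiftAut_cr, ih,
        cutWord_annihilate]
    · rcases m with _ | m
      · rw [List.map_cons, cutWord_create_zero, cutWord_create_zero, map_zero]
      · rw [List.map_cons, cutWord_create_succ, map_mul, shiftAut_cr, ih, cutWord_create_succ]

theorem shiftAut_symm_cutWord (m : ℕ) (w : List (Bool × ℤ)) (n : ℕ) :
    (shiftAut hT hU).symm (cutWord hT m w n) =
      cutWord hT m (w.map fun p => (p.1, p.2 - 1)) n := by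
  rw [StarAlgEquiv.symm_apply_eq, shiftAut_cutWord, List.map_map]
  congr 1
  simp [Function.comp_def]

theorem norm_shiftAut (X : FockSpace hT →L[ℂ] FockSpace hT) : ‖shiftAut hT hU X‖ = ‖X‖ := by
  rw [shiftAut, Unitary.conjStarAlgAut_apply, mul_assoc, CStarRing.norm_coe_unitary_mul]
  exact CStarRing.norm_mul_coe_unitary X (star (fockShift hT hU))

/-- A *-automorphism of the bounded operators that maps the generators of `𝔈_T` into generators maps
`𝔈_T` into itself. -/
theorem map_algE_le (φ : (FockSpace hT →L[ℂ] FockSpace hT) ≃⋆ₐ[ℂ] (FockSpace hT →L[ℂ] FockSpace hT))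
    (hφ : Continuous φ) (h : ∀ m w n, ∃ w', φ (cutWord hT m w n) = cutWord hT m w' n)
    {X : FockSpace hT →L[ℂ] FockSpace hT} (hX : X ∈ algE hT) : φ X ∈ algE hT := by
  refine map_mem_closure (f := φ) hφ hX fun X hX => ?_
  have h1 : StarAlgebra.adjoin ℂ {X | ∃ m w n, X = cutWord hT m w n} ≤
      (StarAlgebra.adjoin ℂ {X | ∃ m w n, X = cutWord hT m w n}).comap φ.toStarAlgHom := by
    refine StarAlgebra.adjoin_le ?_
    rintro _ ⟨m, w, n, rfl⟩
    obtain ⟨w', hw⟩ := h m w n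
    exact StarAlgebra.subset_adjoin ℂ _ ⟨m, w', n, hw⟩
  exact h1 hX

theorem shiftAut_mem_algE {X : FockSpace hT →L[ℂ] FockSpace hT} (hX : X ∈ algE hT) :
    shiftAut hT hU X ∈ algE hT :=
  map_algE_le hT _ (AddMonoidHomClass.isometry_of_norm (shiftAut hT hU)
    (norm_shiftAut hT hU)).continuous (fun m w n => ⟨_, shiftAut_cutWord hT hU m w n⟩) hX

theorem shiftAut_symm_mem_algE {X : FockSpace hT →L[ℂ] FockSpace hT} (hX : X ∈ algE hT) :
    (shiftAut hT hU).symm X ∈ algE hT :=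
  map_algE_le hT _ (AddMonoidHomClass.isometry_of_norm (shiftAut hT hU).symm fun X => by
    rw [← norm_shiftAut hT hU, StarAlgEquiv.apply_symm_apply]).continuous
    (fun m w n => ⟨_, shiftAut_symm_cutWord hT hU m w n⟩) hX

/-- The restriction of the shift automorphism to `𝔈_T`. -/
noncomputable def algEShift : algE hT ≃⋆ₐ[ℂ] algE hT where
  toFun X := ⟨shiftAut hT hU X, shiftAut_mem_algE hT hU X.2⟩
  invFun X := ⟨(shiftAut hT hU).symm X, shiftAut_symm_mem_algE hT hU X.2⟩
  left_inv _ := Subtype.ext ((shiftAut hT hU).symm_apply_apply _)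
  right_inv _ := Subtype.ext ((shiftAut hT hU).apply_symm_apply _)
  map_mul' _ _ := Subtype.ext ((shiftAut hT hU).map_mul' _ _)
  map_add' _ _ := Subtype.ext ((shiftAut hT hU).map_add' _ _)
  map_smul' _ _ := Subtype.ext ((shiftAut hT hU).map_smul' _ _)
  map_star' _ := Subtype.ext (shiftAut_star hT hU _)

theorem coe_algEShift_iterate (X : algE hT) (k : ℕ) :
    (((algEShift hT hU)^[k] X : algE hT) : FockSpace hT →L[ℂ] FockSpace hT) =
      (shiftAut hT hU)^[k] X :=
  (Function.Semiconj.iterate_right (f := Subtype.val) (ga := algEShift hT hU)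
    (gb := shiftAut hT hU) (fun _ => rfl) k) X

end ShiftAction

end TFock

namespace TFock

/-! ### Weak limits of orbits and unique mixing in a general C*-algebra. -/

section WeakLimits

variable {A : Type} [CStarAlgebra A]

/-- `b` is the weak limit of the orbit `αⁿ a`. -/
def IsWeakLimit (α : A ≃⋆ₐ[ℂ] A) (a b : A) : Prop :=
  ∀ f : A →L[ℂ] ℂ, Filter.Tendsto (fun n : ℕ => f (α^[n] a)) Filter.atTop (nhds (f b))

variable {α : A ≃⋆ₐ[ℂ] A} {a a' b b' : A}

theorem norm_iterate (α : A ≃⋆ₐ[ℂ] A) (n : ℕ) (a : A) : ‖α^[n] a‖ = ‖a‖ := by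
  induction n with
  | zero => rfl
  | succ n ih => rw [Function.iterate_succ_apply', StarAlgEquiv.norm_map, ih]

theorem iterate_add (α : A ≃⋆ₐ[ℂ] A) (n : ℕ) (a b : A) :
    α^[n] (a + b) = α^[n] a + α^[n] b := iterate_map_add α n a b

theorem iterate_smul (α : A ≃⋆ₐ[ℂ] A) (n : ℕ) (r : ℂ) (a : A) :
    α^[n] (r • a) = r • α^[n] a := by
  induction n with
  | zero => rfl
  | succ n ih => rw [Function.iterate_succ_apply', ih, map_smul, Function.iterate_succ_apply']

theorem iterate_star (α : A ≃⋆ₐ[ℂ] A) (n : ℕ) (a : A) :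
    α^[n] (star a) = star (α^[n] a) := by
  induction n with
  | zero => rfl
  | succ n ih => rw [Function.iterate_succ_apply', ih, map_star, Function.iterate_succ_apply']

theorem iterate_eq_self {α : A ≃⋆ₐ[ℂ] A} (h : α a = a) (n : ℕ) : α^[n] a = a :=
  Function.iterate_fixed h n

theorem eq_of_forall_functional (h : ∀ f : A →L[ℂ] ℂ, f a = f b) : a = b := by
  rw [← sub_eq_zero]
  exact SeparatingDual.eq_zero_of_forall_dual_eq_zero (R := ℂ) fun f => by
    rw [map_sub, sub_eq_zero]; exact h f

namespace IsWeakLimit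

theorem unique (h : IsWeakLimit α a b) (h' : IsWeakLimit α a b') : b = b' :=
  eq_of_forall_functional fun f => tendsto_nhds_unique (h f) (h' f)

theorem add (h : IsWeakLimit α a b) (h' : IsWeakLimit α a' b') :
    IsWeakLimit α (a + a') (b + b') := fun f => by
  simp only [iterate_add, map_add]
  exact (h f).add (h' f)

theorem smul (r : ℂ) (h : IsWeakLimit α a b) : IsWeakLimit α (r • a) (r • b) := fun f => by
  simp only [iterate_smul, map_smul]
  exact (h f).const_smul r

theorem of_fixed (h : α a = a) : IsWeakLimit α a a := fun f => by
  simp only [iterate_eq_self h]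
  exact tendsto_const_nhds

theorem apply (h : IsWeakLimit α a b) : IsWeakLimit α (α a) b := fun f => by
  simp only [← Function.iterate_succ_apply]
  exact (h f).comp (Filter.tendsto_add_atTop_nat 1)

/-- A continuous operator that intertwines the orbits preserves weak limits. -/
theorem map (L : A →L[ℂ] A) (hL : ∀ n, α^[n] a' = L (α^[n] a)) (h : IsWeakLimit α a b) :
    IsWeakLimit α a' (L b) := fun f => by
  simp only [hL]
  exact h (f ∘L L)

/-- The orbit of `α a` is the image under α of the orbit of `a`, and also that orbit with its first
term dropped. Its weak limit is therefore both `α b` and `b`. -/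
theorem fixed (h : IsWeakLimit α a b) : α b = b := by
  let L : A →L[ℂ] A := ⟨(α : A →ₗ[ℂ] A),
    (AddMonoidHomClass.isometry_of_norm α (StarAlgEquiv.norm_map α)).continuous⟩
  have h1 : IsWeakLimit α (α a) (L b) := h.map L fun n => by
    rw [← Function.iterate_succ_apply, Function.iterate_succ_apply']
    rfl
  exact h1.unique h.apply

theorem norm_le (h : IsWeakLimit α a b) : ‖b‖ ≤ ‖a‖ := by
  refine NormedSpace.norm_le_dual_bound ℂ b (norm_nonneg a) fun f => ?_
  refine le_of_tendsto (h f).norm (Filter.Eventually.of_forall fun n => ?_)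
  rw [mul_comm, ← norm_iterate α n a]
  exact f.le_opNorm _

theorem star (h : IsWeakLimit α a b) : IsWeakLimit α (star a) (star b) := fun f => by
  let g : A →L[ℂ] ℂ :=
    ⟨{ toFun := fun x => Star.star (f (Star.star x))
       map_add' := fun x y => by simp
       map_smul' := fun r x => by simp }, by
      change Continuous fun x => Star.star (f (Star.star x))
      fun_prop⟩
  have h1 := (h g).star
  have h2 : ∀ x, Star.star (g x) = f (Star.star x) := fun x => star_star _
  simp only [h2] at h1
  simpa only [iterate_star] using h1

/-- The positive cone is closed and convex, hence weakly closed by Hahn–Banach, and α maps it into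
itself. -/
theorem nonneg [PartialOrder A] [StarOrderedRing A] (h : IsWeakLimit α a b) (ha : 0 ≤ a) :
    0 ≤ b := by
  have hc : Convex ℝ {x : A | 0 ≤ x} := convex_Ici 0
  by_contra hb
  obtain ⟨f, u, h1, h2⟩ := geometric_hahn_banach_closed_point hc isClosed_Ici hb
  -- The separating functional is only real linear; weak limits are tested on the complex functional
  -- that has it as real part.
  let g : A →L[ℂ] ℂ := StrongDual.extendRCLike f
  have hg : ∀ x, (g x).re = f x := StrongDual.re_extendRCLike_apply (𝕜 := ℂ) f
  have h3 := (Complex.continuous_re.tendsto _).comp (h g)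
  have h4 : f b ≤ u := by
    rw [← hg]
    refine le_of_tendsto h3 (Filter.Eventually.of_forall fun n => ?_)
    change (g (α^[n] a)).re ≤ u
    rw [hg]
    refine (h1 _ ?_).le
    obtain ⟨c, rfl⟩ := CStarAlgebra.nonneg_iff_eq_star_mul_self.1 ha
    have h5 : α^[n] (Star.star c * c) = Star.star (α^[n] c) * α^[n] c := by
      rw [iterate_map_mul α n, iterate_star]
    change 0 ≤ α^[n] (Star.star c * c)
    rw [h5]
    exact star_mul_self_nonneg _
  linarith

/-- The elements whose orbit converges weakly to a point of a closed set form a closed set. -/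
theorem isClosed_setOf (α : A ≃⋆ₐ[ℂ] A) {S : Set A} (hS : IsClosed S) :
    IsClosed {a | ∃ b ∈ S, IsWeakLimit α a b} := by
  refine isClosed_of_closure_subset fun a ha => ?_
  obtain ⟨x, hx, hxa⟩ := mem_closure_iff_seq_limit.1 ha
  choose y hyS hy using hx
  -- Passing to weak limits is linear and does not increase norms, so the limits `y` inherit the
  -- Cauchy property from `x`.
  have hsub : ∀ m n, IsWeakLimit α (x m - x n) (y m - y n) := fun m n => by
    have := (hy m).add ((hy n).smul (-1))
    simpa [sub_eq_add_neg] using this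
  have hcy : CauchySeq y := by
    rw [Metric.cauchySeq_iff]
    intro ε hε
    obtain ⟨N, hN⟩ := Metric.cauchySeq_iff.1 hxa.cauchySeq ε hε
    refine ⟨N, fun m hm n hn => lt_of_le_of_lt ?_ (hN m hm n hn)⟩
    rw [dist_eq_norm, dist_eq_norm]
    exact (hsub m n).norm_le
  obtain ⟨b, hb⟩ := cauchySeq_tendsto_of_complete hcy
  refine ⟨b, hS.mem_of_tendsto hb (Filter.Eventually.of_forall hyS), fun f => ?_⟩
  -- As α is isometric, the approximation is uniform along the orbit, which permits the interchange
  -- of the limits in `j` and `n`.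
  have hu : TendstoUniformly (fun j n => f (α^[n] (x j))) (fun n => f (α^[n] a)) Filter.atTop := by
    have h0 : Filter.Tendsto (fun j => ‖f‖ * ‖a - x j‖) Filter.atTop (nhds 0) := by
      have : Filter.Tendsto (fun j => ‖f‖ * ‖a - x j‖) Filter.atTop (nhds (‖f‖ * ‖a - a‖)) :=
        ((tendsto_const_nhds.sub hxa).norm).const_mul _
      simpa using this
    rw [Metric.tendstoUniformly_iff]
    intro ε hε
    filter_upwards [h0.eventually (gt_mem_nhds hε)] with j hj n
    refine lt_of_le_of_lt ?_ hj
    have h6 : α^[n] a - α^[n] (x j) = α^[n] (a - x j) := (iterate_map_sub α n _ _).symm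
    rw [dist_eq_norm, ← map_sub, h6, ← norm_iterate α n (a - x j)]
    exact f.le_opNorm _
  exact hu.tendsto_of_eventually_tendsto (Filter.Eventually.of_forall fun j => hy j f)
    ((f.continuous.tendsto b).comp hb)

end IsWeakLimit

/-- If every orbit converges weakly then the dynamical system is uniquely mixing. -/
theorem uniquelyMixing_of_forall_isWeakLimit (h : ∀ a, ∃ b, IsWeakLimit α a b) :
    UniquelyMixing α := by
  let : PartialOrder A := CStarAlgebra.spectralOrder A
  have : StarOrderedRing A := CStarAlgebra.spectralOrderedRing A
  choose E hE using h
  let F : A →L[ℂ] A := LinearMap.mkContinuous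
    { toFun := E
      map_add' := fun a b => (hE (a + b)).unique ((hE a).add (hE b))
      map_smul' := fun r a => (hE (r • a)).unique ((hE a).smul r) } 1
    fun a => by rw [one_mul]; exact (hE a).norm_le
  have hF : ∀ a, IsWeakLimit α a (F a) := hE
  refine ⟨F, ⟨fun a => (hF a).fixed, fun a ha => (hF a).unique (.of_fixed ha),
    fun a => (hF a).norm_le, fun a => ?_, fun a b c hb hc => ?_,
    fun a => (hF _).unique (hF a).apply⟩, fun E' hE' => ?_, hF⟩
  · exact CStarAlgebra.nonneg_iff_eq_star_mul_self.1 ((hF _).nonneg (star_mul_self_nonneg a))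
  -- For fixed `b` and `c`, the bounded map x ↦ b x c commutes with α.
  · refine (hF _).unique ((hF a).map (ContinuousLinearMap.mulLeftRight ℂ A b c) fun n => ?_)
    rw [iterate_map_mul, iterate_map_mul, iterate_eq_self hb, iterate_eq_self hc]
    rfl
  · ext a
    refine eq_of_forall_functional fun f => ?_
    -- Along the orbit `f ∘L E'` is constant, equal to f(E' a), by invariance. Its limit is f(E'(F
    -- a)) = f(F a), because `F a` is a fixed point.
    have h1 := hF a (f ∘L E')
    have h2 : ∀ n, E' (α^[n] a) = E' a := fun n => by
      induction n with
      | zero => rfl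
      | succ n ih => rw [Function.iterate_succ_apply', hE'.invariant, ih]
    simp only [ContinuousLinearMap.comp_apply, h2, hE'.apply_of_fixed _ (hF a).fixed] at h1
    exact tendsto_nhds_unique tendsto_const_nhds h1

end WeakLimits

/-! ### Weakly null sequences from square-root growth of finite sums. -/

section Averages

/-- A bounded sequence whose sums over finite index sets have norm `O(√card)` is weakly null. -/
theorem tendsto_zero_of_norm_sum_le {E : Type*} [NormedAddCommGroup E] [NormedSpace ℂ E]
    (x : ℕ → E) (C : ℝ) (h : ∀ J : Finset ℕ, ‖∑ n ∈ J, x n‖ ≤ C * √J.card) (f : E →L[ℂ] ℂ) :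
    Filter.Tendsto (fun n => f (x n)) Filter.atTop (nhds 0) := by
  -- An infinite set of this kind would contain N indices for every N, and summing over them gives
  -- Nε ≤ ‖r‖‖f‖C√N, which fails for large N.
  have key : ∀ (r : ℂ) (ε : ℝ), 0 < ε → {n | ε ≤ (r * f (x n)).re}.Finite := by
    intro r ε hε
    by_contra hinf
    have hb : ∀ N : ℕ, √N * ε ≤ ‖r‖ * ‖f‖ * C := fun N => by
      rcases Nat.eq_zero_or_pos N with rfl | hN
      · have := h {0}
        simp only [Finset.sum_singleton, Finset.card_singleton, Nat.cast_one, Real.sqrt_one,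
          mul_one] at this
        have hC : 0 ≤ C := (norm_nonneg _).trans this
        simp only [Nat.cast_zero, Real.sqrt_zero, zero_mul]
        positivity
      obtain ⟨J, hJ, hcard⟩ := Set.Infinite.exists_subset_card_eq hinf N
      have h1 : N * ε ≤ (r * f (∑ n ∈ J, x n)).re := by
        rw [map_sum, Finset.mul_sum, Complex.re_sum, ← hcard, ← nsmul_eq_mul]
        exact Finset.card_nsmul_le_sum J _ _ fun n hn => hJ hn
      have h2 : (r * f (∑ n ∈ J, x n)).re ≤ ‖r‖ * (‖f‖ * (C * √N)) := by
        refine (Complex.re_le_norm _).trans ?_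
        rw [norm_mul]
        gcongr
        refine (f.le_opNorm _).trans ?_
        gcongr
        rw [← hcard]
        exact h J
      have h3 : 0 < √(N : ℝ) := Real.sqrt_pos.2 (Nat.cast_pos.2 hN)
      have h4 : √(N : ℝ) * √N = N := Real.mul_self_sqrt (Nat.cast_nonneg _)
      refine le_of_mul_le_mul_right ?_ h3
      linarith [h1.trans h2, congrArg (· * ε) h4,
        show √(N : ℝ) * ε * √N = √(N : ℝ) * √N * ε by ring]
    have h5 : Filter.Tendsto (fun N : ℕ => √(N : ℝ) * ε) Filter.atTop Filter.atTop :=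
      (Real.tendsto_sqrt_atTop.comp tendsto_natCast_atTop_atTop).atTop_mul_const hε
    obtain ⟨N, hN⟩ := (h5.eventually (Filter.eventually_gt_atTop (‖r‖ * ‖f‖ * C))).exists
    exact absurd (hb N) (not_le.2 hN)
  rw [Metric.tendsto_atTop']
  intro ε hε
  -- The multipliers 1, -1, i and -i bound the real and imaginary parts of f(x_n) from both sides.
  have hfin := ((key 1 (ε / 2) (by linarith)).union (key (-1) (ε / 2) (by linarith))).union
    ((key Complex.I (ε / 2) (by linarith)).union (key (-Complex.I) (ε / 2) (by linarith)))
  obtain ⟨N, hN⟩ := hfin.bddAbove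
  refine ⟨N, fun n hn => ?_⟩
  have h6 : n ∉ _ := fun hmem => absurd (hN hmem) (not_le.2 hn)
  simp only [Set.mem_union, Set.mem_ofPred_eq, not_or, not_le, Complex.mul_re, Complex.one_re,
    Complex.one_im, Complex.neg_re, Complex.neg_im, Complex.I_re, Complex.I_im] at h6
  rw [dist_zero_right]
  refine (Complex.norm_le_abs_re_add_abs_im _).trans_lt ?_
  have h7 : |(f (x n)).re| < ε / 2 := abs_lt.2 ⟨by linarith [h6.1.2], by linarith [h6.1.1]⟩
  have h8 : |(f (x n)).im| < ε / 2 := abs_lt.2 ⟨by linarith [h6.2.1], by linarith [h6.2.2]⟩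
  linarith

end Averages

end TFock

namespace TFock

/-! ### The flip satisfies the hypotheses and has unbounded R^{(n)}. -/

section Flip

theorem flip_apply (ξ : Ell2 (ℤ × ℤ)) (i j : ℤ) : flip ξ (i, j) = ξ (j, i) := rfl

theorem flip_mul_flip : flip * flip = 1 := rfl

theorem inner_flip_left (ξ η : Ell2 (ℤ × ℤ)) : inner ℂ (flip ξ) η = inner ℂ ξ (flip η) := by
  have h := LinearIsometryEquiv.inner_map_map (𝕜 := ℂ) (reindex (Equiv.prodComm ℤ ℤ)) ξ (flip η)
  exact h

theorem isSelfAdjoint_flip : IsSelfAdjoint flip := by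
  rw [ContinuousLinearMap.isSelfAdjoint_iff_isSymmetric]
  exact inner_flip_left

/-- The flip is a selfadjoint involution, so half of `flip + 1` is a projection. -/
theorem isPositive_flip_add_one : (flip + 1).IsPositive := by
  have h : flip + 1 = (2⁻¹ : ℂ) • (star (flip + 1) * (flip + 1)) := by
    rw [star_add, isSelfAdjoint_flip.star_eq, star_one, add_mul, mul_add, mul_one, one_mul,
      flip_mul_flip]
    module
  rw [h]
  exact ((ContinuousLinearMap.nonneg_iff_isPositive _).1
    (star_mul_self_nonneg (flip + 1))).smul_of_nonneg (by norm_num [Complex.le_def])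

theorem braid_flip_three_zero (ξ : HPow 3) (a b c : ℤ) :
    braid flip 3 0 ξ ![a, b, c] = ξ ![b, a, c] := by
  change flip (slice (headE 1) ![c] ξ) (a, b) = _
  rw [flip_apply, slice_apply]
  congr 1

theorem braid_flip_three_one (ξ : HPow 3) (a b c : ℤ) :
    braid flip 3 1 ξ ![a, b, c] = ξ ![a, c, b] := by
  change flip (slice (headE 0) ![] (slice (consE 2) a ξ)) (b, c) = _
  rw [flip_apply, slice_apply, slice_apply]
  congr 1

theorem isYangBaxterHecke_flip : IsYangBaxterHecke flip where
  isSelfAdjoint := isSelfAdjoint_flip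
  ge_neg_one := isPositive_flip_add_one
  yang_baxter := by
    ext1 ξ
    ext z
    obtain ⟨a, b, c, rfl⟩ : ∃ a b c, z = ![a, b, c] :=
      ⟨z 0, z 1, z 2, by ext i; fin_cases i <;> rfl⟩
    change braid flip 3 0 (braid flip 3 1 (braid flip 3 0 ξ)) _ =
      braid flip 3 1 (braid flip 3 0 (braid flip 3 1 ξ)) _
    -- Both sides reverse the three coordinates: this is the braid relation for adjacent
    -- transpositions.
    simp only [braid_flip_three_zero, braid_flip_three_one]
  hecke := ⟨1, by norm_num, by rw [flip_mul_flip]; simp⟩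

theorem commutesWithShift_flip : CommutesWithShift flip := fun _ => rfl

theorem coeff_flip (i j k l : ℤ) : coeff flip i j k l = if (l, k) = (i, j) then 1 else 0 := by
  rw [coeff, flip_apply, lp.coeFn_single, Pi.single_apply]

/-- Only (k, l) = (j, i) contributes, as in the Bose relation a_i a_j† - a_j† a_i = δ_{ij} I. -/
theorem finiteCommutationRule_flip : FiniteCommutationRule flip := fun i j => by
  refine (Set.finite_singleton (j, i)).subset fun p hp => ?_
  rw [Set.mem_ofPred_eq, coeff_flip] at hp
  obtain ⟨k, l⟩ := p
  simp_all

/-- The vector `e_0 ⊗ ⋯ ⊗ e_0`. -/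
noncomputable def zeroVec (n : ℕ) : HPow n := lp.single 2 0 1

theorem slice_consE_zeroVec (n : ℕ) (i : ℤ) :
    slice (consE n) i (zeroVec (n + 1)) = (if i = 0 then (1 : ℂ) else 0) • zeroVec n := by
  ext z
  change (lp.single 2 0 (1 : ℂ) : HPow (n + 1)) (Fin.cons i z) =
    _ * (lp.single 2 0 (1 : ℂ) : HPow n) z
  rw [lp.coeFn_single, lp.coeFn_single, Pi.single_apply, Pi.single_apply]
  have h : (Fin.cons i z : Fin (n + 1) → ℤ) = 0 ↔ i = 0 ∧ z = 0 := by
    simp only [funext_iff, Fin.forall_fin_succ, Fin.cons_zero, Fin.cons_succ, Pi.zero_apply]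
  simp only [h]
  split_ifs <;> simp_all

theorem braid_flip_zeroVec : ∀ n k, k + 1 < n → braid flip n k (zeroVec n) = zeroVec n
  | 0, _, h => by omega
  | 1, _, h => by omega
  | n + 2, 0, _ => by
    refine ext_slice (headE n) fun z => ?_
    rw [braid, slice_amp]
    ext ⟨a, b⟩
    rw [flip_apply, slice_apply, slice_apply]
    change (lp.single 2 0 (1 : ℂ) : HPow (n + 2)) (Fin.cons b (Fin.cons a z : Fin (n + 1) → ℤ)) =
      (lp.single 2 0 (1 : ℂ) : HPow (n + 2)) (Fin.cons a (Fin.cons b z : Fin (n + 1) → ℤ))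
    rw [lp.coeFn_single, Pi.single_apply, Pi.single_apply]
    simp only [funext_iff, Fin.forall_fin_succ, Fin.cons_zero, Fin.cons_succ, Pi.zero_apply]
    congr 1
    exact propext (by tauto)
  | n + 2, k + 1, h => by
    refine ext_slice (consE (n + 1)) fun i => ?_
    rw [braid, slice_amp, slice_consE_zeroVec, map_smul, braid_flip_zeroVec (n + 1) k (by omega)]

/-- The symmetric vector is fixed by each of the n products T₁⋯T_j that make up R^{(n)}, which
forces ‖R^{(n)}‖ ≥ n. -/
theorem opR_flip_zeroVec (n : ℕ) : opR flip n (zeroVec n) = (n : ℂ) • zeroVec n := by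
  have h : ∀ l : List ℕ, (∀ k ∈ l, k + 1 < n) →
      (l.map (braid flip n)).prod (zeroVec n) = zeroVec n := fun l => by
    induction l with
    | nil => exact fun _ => rfl
    | cons k l ih =>
      intro hl
      rw [List.map_cons, List.prod_cons]
      change braid flip n k ((l.map (braid flip n)).prod (zeroVec n)) = _
      rw [ih fun j hj => hl j (List.mem_cons_of_mem _ hj),
        braid_flip_zeroVec n k (hl k List.mem_cons_self)]
  rw [opR, sum_apply, Finset.sum_congr rfl fun j hj => h (List.range j) fun k hk => ?_]
  · rw [Finset.sum_const, Finset.card_range, Nat.cast_smul_eq_nsmul]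
  · have h1 := List.mem_range.1 hk
    have h2 := Finset.mem_range.1 hj
    omega

theorem not_bddAbove_norm_opR_flip :
    ¬ BddAbove (Set.range fun n : ℕ => ‖opR flip n‖) := by
  rintro ⟨C, hC⟩
  obtain ⟨n, hn⟩ := exists_nat_gt C
  refine absurd (hC ⟨n, rfl⟩) (not_le.2 (hn.trans_le ?_))
  have h := (opR flip n).le_opNorm (zeroVec n)
  rw [opR_flip_zeroVec, norm_smul, zeroVec, lp.norm_single (by norm_num), norm_one, mul_one,
    mul_one, Complex.norm_natCast] at h
  exact h

end Flip

end TFock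

namespace TFock

/-! ### Weak convergence of orbits in 𝔈_T and conclusion. -/

variable {T : Ell2 (ℤ × ℤ) →L[ℂ] Ell2 (ℤ × ℤ)} {hT : IsYangBaxterHecke T}

/-- A normal ordered product with a creation operator on the left is weakly mixed to zero. -/
theorem isWeakLimit_cr_mul (hU : CommutesWithShift T) (i : ℤ) (m : ℕ)
    (X : FockSpace hT →L[ℂ] FockSpace hT) :
    IsWeakLimit (shiftAut hT hU) (cr hT i m * X) 0 := fun f => by
  obtain ⟨K, -, h⟩ := norm_sum_cr_mul_le hT m
  rw [map_zero]
  refine tendsto_zero_of_norm_sum_le _ (K * ‖X‖) (fun J => ?_) f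
  let e : ℕ ↪ ℤ := ⟨fun n => i + n, fun a b hab => by simpa using hab⟩
  -- The estimate is indexed by the mode k = i + n, so the exponent n is recovered as `(k -
  -- i).toNat`; the right factors αⁿ(X) all have norm ‖X‖.
  have h1 := h (J.map e) (fun k => (shiftAut hT hU)^[(k - i).toNat] X) ‖X‖
    fun k _ => (norm_iterate _ _ _).le
  rw [Finset.sum_map, Finset.card_map] at h1
  refine (congrArg norm (Finset.sum_congr rfl fun n _ => ?_)).trans_le h1
  have h2 : (e n - i).toNat = n := by
    change (i + (n : ℤ) - i).toNat = n
    omega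
  rw [iterate_map_mul, shiftAut_iterate_cr, h2]
  rfl

theorem IsNormalOrdered.exists_isWeakLimit (hU : CommutesWithShift T)
    {X : FockSpace hT →L[ℂ] FockSpace hT} (hX : IsNormalOrdered hT X) :
    ∃ Y ∈ algE hT, IsWeakLimit (shiftAut hT hU) X Y := by
  cases hX with
  | proj n => exact ⟨_, proj_mem_algE n, .of_fixed (shiftAut_proj hT hU n)⟩
  | cr_mul i m X _ => exact ⟨0, zero_mem _, isWeakLimit_cr_mul hU i m X⟩
  | mul_star_cr i m X _ =>
    have h := (isWeakLimit_cr_mul hU i m (Star.star X)).star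
    rw [star_mul, star_star, star_zero] at h
    exact ⟨0, zero_mem _, h⟩

/-- Elements whose orbit has a weak limit in 𝔈_T form a closed subspace, so normal ordering leaves
only the identity and single normal ordered products to check. -/
theorem exists_isWeakLimit_of_mem_algE (hU : CommutesWithShift T) (hf : FiniteCommutationRule T)
    {X : FockSpace hT →L[ℂ] FockSpace hT} (hX : X ∈ algE hT) :
    ∃ Y ∈ algE hT, IsWeakLimit (shiftAut hT hU) X Y := by
  let V : Submodule ℂ (FockSpace hT →L[ℂ] FockSpace hT) :=
    { carrier := {X | ∃ Y ∈ algE hT, IsWeakLimit (shiftAut hT hU) X Y}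
      zero_mem' := ⟨0, zero_mem _, .of_fixed (map_zero (shiftAut hT hU))⟩
      add_mem' := by
        rintro _ _ ⟨Y, hY, h⟩ ⟨Y', hY', h'⟩
        exact ⟨_, add_mem hY hY', h.add h'⟩
      smul_mem' := by
        rintro r _ ⟨Y, hY, h⟩
        exact ⟨_, (algE hT).smul_mem hY r, h.smul r⟩ }
  have hV : IsClosed (V : Set (FockSpace hT →L[ℂ] FockSpace hT)) :=
    IsWeakLimit.isClosed_setOf (shiftAut hT hU) (StarSubalgebra.isClosed_topologicalClosure _)
  refine Submodule.topologicalClosure_minimal _ (t := V) (sup_le ?_ ?_) hV (algE_le_closure hf hX)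
  · rw [Submodule.span_singleton_le_iff_mem]
    exact ⟨1, one_mem _, .of_fixed (map_one (shiftAut hT hU))⟩
  · exact Submodule.span_le.2 fun X hX => hX.exists_isWeakLimit hU

theorem uniquelyMixing_algEShift (hU : CommutesWithShift T) (hf : FiniteCommutationRule T) :
    UniquelyMixing (algEShift hT hU) := by
  refine uniquelyMixing_of_forall_isWeakLimit fun X => ?_
  obtain ⟨Y, hY, h⟩ := exists_isWeakLimit_of_mem_algE hU hf X.2
  refine ⟨⟨Y, hY⟩, fun f => ?_⟩
  -- The convergence above is tested by functionals on all bounded operators; Hahn–Banach extends a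
  -- functional on 𝔈_T to one of these.
  obtain ⟨g, hg, -⟩ := exists_extension_norm_eq (𝕜 := ℂ) (algE hT).toSubalgebra.toSubmodule f
  have hg' : ∀ x : algE hT, f x = g x := fun x => (hg x).symm
  simp only [hg', coe_algEShift_iterate]
  exact h g

end TFock

theorem proposition6p1 :
    (∀ (T : TFock.Ell2 (ℤ × ℤ) →L[ℂ] TFock.Ell2 (ℤ × ℤ)) (hT : TFock.IsYangBaxterHecke T)
      (hU : TFock.CommutesWithShift T), TFock.FiniteCommutationRule T →
        ∃ α : TFock.algE hT ≃⋆ₐ[ℂ] TFock.algE hT,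
          (∀ X : TFock.algE hT, (α X : TFock.FockSpace hT →L[ℂ] TFock.FockSpace hT) =
            TFock.shiftAut hT hU X) ∧
          TFock.UniquelyMixing α) ∧
    (TFock.IsYangBaxterHecke TFock.flip ∧ TFock.CommutesWithShift TFock.flip ∧
      TFock.FiniteCommutationRule TFock.flip ∧
      ¬ BddAbove (Set.range fun n : ℕ => ‖TFock.opR TFock.flip n‖)) :=
  ⟨fun _ hT hU hf => ⟨TFock.algEShift hT hU, fun _ => rfl,
    TFock.uniquelyMixing_algEShift hU hf⟩,
    TFock.isYangBaxterHecke_flip, TFock.commutesWithShift_flip, TFock.finiteCommutationRule_flip,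
    TFock.not_bddAbove_norm_opR_flip⟩
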